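/- \textbf{Model.} Let $\Delta\ge 1$ and $w\ge 1$ be integers and let $0<p<1/w$. A static connected graph $G=(V,E)$ with $|V|=n\ge 1$ and maximum degree at most $\Delta$ has one agent at each vertex. Each agent is in one of six states: the Unaware state $\mathcal U$, or one of the Aware states $\mathcal A_\emptyset,\mathcal A_{\{A\}},\mathcal A_{\{W\}},\mathcal A_{\{A,W\}},\mathcal A_{\{C\}}$ ($A$: alert token, $W$: witness flag, $C$: all-clear token). In iteration $t\in\{1,2,\dots\}$ there is a set of witnesses $\mathcal W_t\subseteq V$ with $|\mathcal W_t|\le w$, chosen by an adversary who may use everything that happened in iterations $1,\dots,t-1$. An agent $u$ is chosen uniformly at random from $V$, independently of the past, and acts as follows (Adaptive Stimuli Algorithm): (1) If $u\in\mathcal W_t$ and its state is not $\mathcal A_{\{W\}}$ or $\mathcal A_{\{A,W\}}$, then $u$ switches to $\mathcal A_{\{W\}}$ with probability $p$, and otherwise nothing changes. (2) If $u\notin\mathcal W_t$ and its state is $\mathcal A_{\{W\}}$ or $\mathcal A_{\{A,W\}}$, then all Aware neighbors of $u$ switch to $\mathcal A_{\{C\}}$, and $u$ switches to $\mathcal U$.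 (3) Otherwise the action depends on the state of $u$. In state $\mathcal U$: if some neighbor holds an alert token (is in state $\mathcal A_{\{A\}}$ or $\mathcal A_{\{A,W\}}$), one such neighbor $v$ is selected (by any fixed, possibly randomized, rule), $v$ loses its alert token, and $u$ switches to $\mathcal A_\emptyset$. In state $\mathcal A_{\{A\}}$ or $\mathcal A_{\{A,W\}}$: each neighbor $v$ of $u$ is picked with probability $1/\Delta$ (with the remaining probability $1-\deg(u)/\Delta$ nothing happens); if the picked $v$ is in state $\mathcal A_\emptyset$ or $\mathcal A_{\{W\}}$, the alert token moves from $u$ to $v$. In state $\mathcal A_{\{W\}}$: with probability $p$, $u$ switches to $\mathcal A_{\{A,W\}}$. In state $\mathcal A_{\{C\}}$: all Aware neighbors of $u$ switch to $\mathcal A_{\{C\}}$, and $u$ switches to $\mathcal U$. In state $\mathcal A_\emptyset$: nothing happens. A configuration satisfies the \emph{state invariant} if every connected component of the subgraph of $G$ induced by the Aware agents contains an agent in state $\mathcal A_{\{W\}}$, $\mathcal A_{\{A,W\}}$ or $\mathcal A_{\{C\}}$. \textbf{Theorem.} There is a constant $K$, depending only on $\Delta$, $w$ and $p$, such that the following holds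 for every $n\ge 1$ and every such graph $G$ on $n$ vertices. Start from any configuration satisfying the state invariant, and let $T\in\mathbb N$ be such that $\mathcal W_t=\mathcal W_T$ for all $t\ge T$ and $|\mathcal W_T|>0$. Then the number of iterations after time $T$ until all agents have reached, and from then on stay forever in, the Aware states has expectation at most $K n^5$ (in particular it is almost surely finite). -/

import Mathlib

open MeasureTheory
open scoped ENNReal

/-- The six states of an agent: the Unaware state, and the Aware states
`𝒜_∅`, `𝒜_{A}`, `𝒜_{W}`, `𝒜_{A,W}`, `𝒜_{C}`
(flags: `A` alert token, `W` witness flag, `C` all-clear token). -/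
inductive AgentState : Type
  | unaware
  | aware
  | awareA
  | awareW
  | awareAW
  | awareC
  deriving DecidableEq

namespace AgentState

/-- The state is one of the five Aware states. -/
def isAware : AgentState → Bool
  | unaware => false
  | _ => true

/-- The alert token flag is set. -/
def hasAlert : AgentState → Bool
  | awareA => true
  | awareAW => true
  | _ => false

/-- The witness flag is set. -/
def hasWitnessFlag : AgentState → Bool
  | awareW => true
  | awareAW => true
  | _ => false

/-- The all-clear token flag is set. -/
def hasClear : AgentState → Bool
  | awareC => true
  | _ => false

/-- An Aware state with neither an alert token nor an all-clear token. -/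
def canReceiveAlert : AgentState → Bool
  | aware => true
  | awareW => true
  | _ => false

/-- Remove the alert token: `𝒜_S ↦ 𝒜_{S \ {A}}`. -/
def dropAlert : AgentState → AgentState
  | awareA => aware
  | awareAW => awareW
  | s => s

/-- Add an alert token: `𝒜_S ↦ 𝒜_{S ∪ {A}}`, for `S = ∅` and `S = {W}`. -/
def addAlert : AgentState → AgentState
  | aware => awareA
  | awareW => awareAW
  | s => s

end AgentState

/-- A configuration assigns a state to each agent (vertex). -/
abbrev AgentConfig (V : Type*) := V → AgentState

/-- All agents are in an Aware state. -/
def AllAware {V : Type*} (σ : AgentConfig V) : Prop := ∀ v, (σ v).isAware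

/-- State invariant: every connected component of the subgraph induced by the Aware agents
contains an agent in one of the states `𝒜_{W}`, `𝒜_{A,W}`, `𝒜_{C}`. -/
def StateInvariant {V : Type*} (G : SimpleGraph V) (σ : AgentConfig V) : Prop :=
  ∀ K : (G.induce {v | (σ v).isAware}).ConnectedComponent,
    ∃ v ∈ K.supp, (σ v).hasWitnessFlag ∨ (σ v).hasClear

/-- `v` is a neighbor of `u` that holds an alert token. -/
def IsAlertNeighbor {V : Type*} (G : SimpleGraph V) (σ : AgentConfig V) (u v : V) : Prop :=
  G.Adj u v ∧ (σ v).hasAlert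

/-- A (possibly randomized) rule by which an Unaware agent chooses the neighbor whose alert
token it consumes: whenever some neighbor holds an alert token, the rule selects such a neighbor.
Any such rule is allowed. -/
def IsSelectionRule {V : Type*} (G : SimpleGraph V) (sel : AgentConfig V → V → PMF V) : Prop :=
  ∀ σ u, (∃ v, IsAlertNeighbor G σ u v) → ∀ v ∈ (sel σ u).support, IsAlertNeighbor G σ u v

/-- A biased coin: `true` with probability `q` (for `q` in `[0, 1]`; `q` is clamped to `[0, 1]`,
so this is also the law of the truth value of `x ≤ q` for `x` uniform in `[0, 1]`). -/
noncomputable def coin (q : ℝ) : PMF Bool :=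
  PMF.ofFintype (fun b => if b then min (ENNReal.ofReal q) 1 else 1 - min (ENNReal.ofReal q) 1)
    (by simp)

section Algorithm

variable {V : Type*} [Fintype V] [DecidableEq V]

/-- `u` becomes Unaware and every Aware neighbor of `u` is set to `𝒜_{C}`. -/
def broadcastClear (G : SimpleGraph V) [DecidableRel G.Adj] (u : V) (σ : AgentConfig V) :
    AgentConfig V := fun v =>
  if v = u then .unaware
  else if G.Adj u v ∧ (σ v).isAware then .awareC
  else σ v

/-- `u` hands its alert token over to `v`, provided `v` is Aware and has neither an alert token
nor an all-clear token; otherwise nothing happens. -/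
def passAlert (u v : V) (σ : AgentConfig V) : AgentConfig V :=
  if (σ v).canReceiveAlert then
    Function.update (Function.update σ u (σ u).dropAlert) v (σ v).addAlert
  else σ

/-- `u` consumes the alert token of `v` and becomes Aware. -/
def consumeAlert (u v : V) (σ : AgentConfig V) : AgentConfig V :=
  Function.update (Function.update σ v (σ v).dropAlert) u .aware

open Classical in
/-- The Adaptive Stimuli Algorithm: law of the configuration after the activation of agent `u` in
configuration `σ`, when `W` is the current set of witnesses. -/
noncomputable def activate (G : SimpleGraph V) [DecidableRel G.Adj] (Δ : ℕ) (p : ℝ)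
    (sel : AgentConfig V → V → PMF V) (W : Finset V) (u : V) (σ : AgentConfig V) :
    PMF (AgentConfig V) :=
  if u ∈ W ∧ ¬ (σ u).hasWitnessFlag then
    (coin p).bind fun b => PMF.pure (if b then Function.update σ u .awareW else σ)
  else if u ∉ W ∧ (σ u).hasWitnessFlag then
    PMF.pure (broadcastClear G u σ)
  else
    match σ u with
    | .unaware =>
        if ∃ v, IsAlertNeighbor G σ u v then
          (sel σ u).bind fun v => PMF.pure (consumeAlert u v σ)
        else PMF.pure σ
    | .aware => PMF.pure σ
    | .awareA | .awareAW =>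
        if h : (G.neighborFinset u).Nonempty then
          (coin ((G.degree u : ℝ) / (Δ : ℝ))).bind fun b =>
            if b then
              (PMF.uniformOfFinset (G.neighborFinset u) h).bind fun v =>
                PMF.pure (passAlert u v σ)
            else PMF.pure σ
        else PMF.pure σ
    | .awareW => (coin p).bind fun b => PMF.pure (if b then Function.update σ u .awareAW else σ)
    | .awareC => PMF.pure (broadcastClear G u σ)

/-- One iteration: an agent chosen uniformly at random is activated. -/
noncomputable def iteration [Nonempty V] (G : SimpleGraph V) [DecidableRel G.Adj] (Δ : ℕ) (p : ℝ)
    (sel : AgentConfig V → V → PMF V) (W : Finset V) (σ : AgentConfig V) : PMF (AgentConfig V) :=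
  (PMF.uniformOfFintype V).bind fun u => activate G Δ p sel W u σ

/-- `X` is an execution from `σ₀`, with `X t` the configuration after iteration `t`, against the
(adaptive, possibly randomized) choice of witness sets `𝒲`, at most `w` witnesses at a time.
`ℱ t` is what is known after iteration `t`. The set `𝒲 (t + 1)` used in iteration `t + 1` is
determined by `ℱ t`, and `step` says that the conditional law of `X (t + 1)` given `ℱ t` is that of
one iteration of the algorithm from `X t` with witness set `𝒲 (t + 1)`. -/
structure IsExecution [Nonempty V] (G : SimpleGraph V) [DecidableRel G.Adj] (Δ w : ℕ) (p : ℝ)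
    (sel : AgentConfig V → V → PMF V) (σ₀ : AgentConfig V)
    {Ω : Type*} [mΩ : MeasurableSpace Ω] (P : Measure Ω) (ℱ : Filtration ℕ mΩ)
    (𝒲 : ℕ → Ω → Finset V) (X : ℕ → Ω → AgentConfig V) : Prop where
  init : ∀ ω, X 0 ω = σ₀
  card_le : ∀ t ω, (𝒲 t ω).card ≤ w
  adapted : ∀ t σ, MeasurableSet[ℱ t] {ω | X t ω = σ}
  predictable : ∀ t S, MeasurableSet[ℱ t] {ω | 𝒲 (t + 1) ω = S}
  step : ∀ t σ A, MeasurableSet[ℱ t] A →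
    P (A ∩ {ω | X (t + 1) ω = σ}) =
      ∫⁻ ω in A, iteration G Δ p sel (𝒲 (t + 1) ω) (X t ω) σ ∂P

end Algorithm

/-- The number of iterations after time `T` until all agents have reached, and from then on stay
in, the Aware state (`∞` if this never happens), for a sequence of configurations `x`. -/
noncomputable def awareTime {V : Type*} (x : ℕ → AgentConfig V) (T : ℕ) : ℝ≥0∞ :=
  ⨅ (k : ℕ) (_ : ∀ t, T + k ≤ t → AllAware (x t)), (k : ℝ≥0∞)

/-! Once the witness set is a constant `W`, the proof uses a function `H ≥ 0` on configurations,
bounded by a constant times `n ^ 5`, whose expectation drops by at least `1` per iteration while `H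
≠ 0`, and whose zeros are fully aware and absorbing. The expected number of iterations with `H ≠ 0`
is then at most the bound on `H`. `H` glues three regimes, each larger than every value of the later
ones, so a change of regime never costs anything.

Residual agents (outside `W`, with a witness flag or an all-clear token): the number of aware agents
plus alert tokens drops by at least one when a residual agent acts, rises in expectation by at most
`p` when a witness acts, and does not rise otherwise. As `p * W.card < 1`, the drift is negative.
Without residual agents no all-clear broadcast can occur, so none ever reappear and awareness and
witness flags are never lost.

Unflagged witnesses: each gets its flag with probability `p / n` per iteration.

All witnesses flagged: call an aware agent without alert token a vacancy. Vacancies perform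
symmetric exclusion on the aware set `A`, and one at a witness `x` is filled with probability `p`
when `x` acts. Linear functionals do not see the exclusion, so vacancies may be treated as
independent walks killed at `x`. Let `g` be the voltage of a unit current from `b` to `x`, where `b
∈ A` has an unaware neighbor. Up to scaling, the sum of `g` over the vacancies has drift at most
minus the indicator that `b` is vacant. If `b` is not vacant it holds a token, which an unaware
neighbor consumes with probability at least `1 / n`; the term `M` times the number of unaware agents
then drops by enough to pay for replacing `g` by the voltage of the larger set. An energy estimate
gives `g = O(n ^ 2)`, hence `M = O(n ^ 4)` and a total of `O(n ^ 5)`. The carrying lemmas are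
`exists_voltage`, `sum_exclusion_eq`, `expect_iteration_alertPotential_le`, `exists_potential` and
`IsExecution.lintegral_awareTime_le`. -/

/-! ### Real expectations under finite probability mass functions -/

namespace PMF

variable {α β : Type*} [Fintype α] [Fintype β]

/-- The expectation of a real function under a probability mass function on a finite type. -/
noncomputable def expect (μ : PMF α) (f : α → ℝ) : ℝ := ∑ a, (μ a).toReal * f a

theorem sum_toReal_eq_one (μ : PMF α) : ∑ a, (μ a).toReal = 1 := by
  rw [← ENNReal.toReal_sum (fun a _ => μ.apply_ne_top a)]
  have h := μ.tsum_coe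
  rw [tsum_fintype] at h
  simp [h]

theorem expect_pure (a : α) (f : α → ℝ) : (PMF.pure a).expect f = f a := by
  classical
  unfold expect
  rw [Finset.sum_eq_single a] <;> simp +contextual

theorem expect_bind (μ : PMF α) (k : α → PMF β) (f : β → ℝ) :
    (μ.bind k).expect f = μ.expect fun a => (k a).expect f := by
  have h : ∀ b, (μ.bind k b).toReal = ∑ a, (μ a).toReal * (k a b).toReal := by
    intro b
    rw [PMF.bind_apply, tsum_fintype, ENNReal.toReal_sum]
    · simp
    · exact fun a _ => ENNReal.mul_ne_top (μ.apply_ne_top a) ((k a).apply_ne_top b)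
  simp only [expect, h, Finset.sum_mul, Finset.mul_sum]
  rw [Finset.sum_comm]
  simp only [mul_assoc]

theorem expect_const (μ : PMF α) (c : ℝ) : (μ.expect fun _ => c) = c := by
  simp [expect, ← Finset.sum_mul, sum_toReal_eq_one]

theorem expect_nonneg (μ : PMF α) {f : α → ℝ} (hf : ∀ a, 0 ≤ f a) : 0 ≤ μ.expect f :=
  Finset.sum_nonneg fun a _ => mul_nonneg ENNReal.toReal_nonneg (hf a)

theorem expect_mono (μ : PMF α) {f g : α → ℝ} (h : ∀ a ∈ μ.support, f a ≤ g a) :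
    μ.expect f ≤ μ.expect g := by
  refine Finset.sum_le_sum fun a _ => ?_
  by_cases ha : a ∈ μ.support
  · exact mul_le_mul_of_nonneg_left (h a ha) ENNReal.toReal_nonneg
  · rw [PMF.mem_support_iff, not_not] at ha
    simp [ha]

theorem expect_le_const (μ : PMF α) {f : α → ℝ} {c : ℝ} (h : ∀ a ∈ μ.support, f a ≤ c) :
    μ.expect f ≤ c :=
  (μ.expect_mono h).trans_eq (μ.expect_const c)

theorem expect_coin {q : ℝ} (h0 : 0 ≤ q) (h1 : q ≤ 1) (f : Bool → ℝ) :
    (coin q).expect f = q * f true + (1 - q) * f false := by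
  have h : min (ENNReal.ofReal q) 1 = ENNReal.ofReal q := by
    rw [min_eq_left]; exact ENNReal.ofReal_le_one.2 h1
  have e : (1 - ENNReal.ofReal q).toReal = 1 - q := by
    rw [ENNReal.toReal_sub_of_le (ENNReal.ofReal_le_one.2 h1) (by simp)]
    simp [ENNReal.toReal_ofReal h0]
  simp [expect, coin, h, ENNReal.toReal_ofReal h0, e]

theorem expect_uniformOfFinset (s : Finset α) (hs : s.Nonempty) (f : α → ℝ) :
    (PMF.uniformOfFinset s hs).expect f = (s.card : ℝ)⁻¹ * ∑ a ∈ s, f a := by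
  classical
  simp only [expect, PMF.uniformOfFinset_apply, apply_ite ENNReal.toReal, ite_mul,
    ENNReal.toReal_zero, zero_mul]
  rw [← Finset.sum_filter]
  simp [Finset.mul_sum]

theorem expect_uniformOfFintype [Nonempty α] (f : α → ℝ) :
    (PMF.uniformOfFintype α).expect f = (Fintype.card α : ℝ)⁻¹ * ∑ a, f a := by
  simp [expect, Finset.mul_sum]

theorem sum_mul_ofReal_eq (μ : PMF α) {f : α → ℝ} (hf : ∀ a, 0 ≤ f a) :
    ∑ a, μ a * ENNReal.ofReal (f a) = ENNReal.ofReal (μ.expect f) := by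
  rw [expect, ENNReal.ofReal_sum_of_nonneg fun a _ => mul_nonneg ENNReal.toReal_nonneg (hf a)]
  refine Finset.sum_congr rfl fun a _ => ?_
  rw [ENNReal.ofReal_mul ENNReal.toReal_nonneg, ENNReal.ofReal_toReal (μ.apply_ne_top a)]

theorem expect_add_const (μ : PMF α) (f : α → ℝ) (a c : ℝ) :
    (μ.expect fun x => a * f x + c) = a * μ.expect f + c := by
  have := μ.expect_const c
  simp only [PMF.expect] at this ⊢
  rw [← this, Finset.mul_sum, ← Finset.sum_add_distrib]
  exact Finset.sum_congr rfl fun x _ => by rw [this]; ring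

theorem expect_eq_zero (μ : PMF α) {f : α → ℝ}
    (h : ∀ x ∈ μ.support, f x = 0) : μ.expect f = 0 :=
  Finset.sum_eq_zero fun x _ => by
    by_cases hx : x ∈ μ.support
    · simp [h x hx]
    · rw [mem_support_iff, not_not] at hx
      simp [hx]

end PMF

instance AgentState.instFintype : Fintype AgentState :=
  ⟨{.unaware, .aware, .awareA, .awareW, .awareAW, .awareC}, fun s => by cases s <;> decide⟩

theorem sum_sum_eq_zero_of_antisymm {α : Type*} [Fintype α] {f : α → α → ℝ}
    (hf : ∀ a b, f a b = -f b a) : ∑ a, ∑ b, f a b = 0 := by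
  have h : ∑ a, ∑ b, f a b = -∑ a, ∑ b, f a b := by
    conv_lhs => rw [Finset.sum_comm]
    simp only [← Finset.sum_neg_distrib, ← hf]
  linarith

/-! ### Killed Laplacians and quadratic bounds on voltages -/

namespace SimpleGraph

theorem adj_spanningCoe_induce_iff {V : Type*} {G : SimpleGraph V} {A : Finset V} {a c : V} :
    (G.induce (A : Set V)).spanningCoe.Adj a c ↔ G.Adj a c ∧ a ∈ A ∧ c ∈ A := by
  simp only [map_adj, comap_adj, Function.Embedding.subtype_apply]
  constructor
  · rintro ⟨a, c, h, rfl, rfl⟩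
    exact ⟨h, a.2, c.2⟩
  · rintro ⟨h, ha, hc⟩
    exact ⟨⟨a, ha⟩, ⟨c, hc⟩, h, rfl, rfl⟩

variable {V : Type*} [Fintype V]

/-- The operator `L + κ 1_D`, where `L` is the (positive semidefinite) graph Laplacian: the generator
of a random walk that is killed at rate `κ` on `D`, up to sign. -/
noncomputable def killedLaplacian (H : SimpleGraph V) [DecidableRel H.Adj] (D : V → Prop)
    [DecidablePred D] (κ : ℝ) : (V → ℝ) →ₗ[ℝ] (V → ℝ) where
  toFun g v := (if D v then κ * g v else 0) + ∑ v', if H.Adj v v' then g v - g v' else 0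
  map_add' f g := by
    funext v
    simp only [Pi.add_apply]
    rw [add_add_add_comm, ← Finset.sum_add_distrib]
    congr 1
    · split_ifs <;> ring
    · exact Finset.sum_congr rfl fun v' _ => by split_ifs <;> ring
  map_smul' c g := by
    funext v
    simp only [Pi.smul_apply, smul_eq_mul, RingHom.id_apply, mul_add, Finset.mul_sum]
    congr 1
    · split_ifs <;> ring
    · exact Finset.sum_congr rfl fun v' _ => by split_ifs <;> ring

variable (H : SimpleGraph V) [DecidableRel H.Adj] (D : V → Prop) [DecidablePred D] {κ : ℝ}

theorem killedLaplacian_apply (g : V → ℝ) (v : V) : H.killedLaplacian D κ g v =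
    (if D v then κ * g v else 0) + ∑ v', if H.Adj v v' then g v - g v' else 0 := rfl

/-- Minimum principle: a negative minimum spreads to all neighbors, hence along a walk to a vertex
of `D`, where the killing term would make the operator negative. -/
theorem nonneg_of_killedLaplacian_nonneg (hκ : 0 < κ) (hD : ∀ v, ∃ d, D d ∧ H.Reachable v d)
    {g : V → ℝ} (hg : ∀ v, 0 ≤ H.killedLaplacian D κ g v) (v : V) : 0 ≤ g v := by
  by_contra! hv
  obtain ⟨m, -, hm⟩ := Finset.exists_min_image Finset.univ g ⟨v, Finset.mem_univ v⟩
  have hm0 : g m < 0 := (hm v (Finset.mem_univ v)).trans_lt hv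
  have key : ∀ a, g a = g m → ¬ D a ∧ ∀ b, H.Adj a b → g b = g m := by
    intro a ha
    have h1 := hg a
    rw [killedLaplacian_apply] at h1
    have hle : ∀ b ∈ Finset.univ, (if H.Adj a b then g a - g b else 0) ≤ 0 := by
      intro b hb
      split_ifs
      · linarith [hm b hb]
      · exact le_rfl
    have h2 := Finset.sum_nonpos hle
    have h3 : (if D a then κ * g a else 0) ≤ 0 := by
      split_ifs
      · rw [ha]; exact (mul_neg_of_pos_of_neg hκ hm0).le
      · exact le_rfl
    refine ⟨fun hDa => ?_, fun b hab => ?_⟩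
    · rw [if_pos hDa, ha] at h1
      rw [ha] at h2
      linarith [mul_neg_of_pos_of_neg hκ hm0]
    · have h4 : ∑ b, (if H.Adj a b then g a - g b else 0) = 0 := by linarith
      have h5 := (Finset.sum_eq_zero_iff_of_nonpos hle).1 h4 b (Finset.mem_univ b)
      rw [if_pos hab] at h5
      linarith
  obtain ⟨d, hd, ⟨q⟩⟩ := hD m
  have : ∀ {a b : V}, H.Walk a b → g a = g m → g b = g m := by
    intro a b q
    induction q with
    | nil => exact id
    | cons h _ ih => exact fun ha => ih ((key _ ha).2 _ h)
  exact (key d (this q rfl)).1 hd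

/-- The minimum principle applied to `g` and `-g` gives injectivity, and the space is
finite-dimensional. -/
theorem exists_killedLaplacian_eq (hκ : 0 < κ) (hD : ∀ v, ∃ d, D d ∧ H.Reachable v d)
    (f : V → ℝ) : ∃ g, H.killedLaplacian D κ g = f := by
  refine LinearMap.surjective_of_injective ?_ f
  rw [injective_iff_map_eq_zero]
  intro g hg
  funext v
  refine le_antisymm ?_ (H.nonneg_of_killedLaplacian_nonneg D hκ hD (by simp [hg]) v)
  have := H.nonneg_of_killedLaplacian_nonneg D hκ hD (g := -g) (by simp [hg]) v
  simpa using this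

theorem sum_adj_sub_eq_zero (g : V → ℝ) :
    ∑ v, ∑ v', (if H.Adj v v' then g v - g v' else 0) = 0 := by
  refine sum_sum_eq_zero_of_antisymm fun v v' => ?_
  simp only [H.adj_comm v' v]
  split_ifs <;> ring

theorem sum_mul_adj_sub (g : V → ℝ) :
    2 * ∑ v, g v * ∑ v', (if H.Adj v v' then g v - g v' else 0) =
      ∑ v, ∑ v', (if H.Adj v v' then (g v - g v') ^ 2 else 0) := by
  have h : ∑ v, g v * ∑ v', (if H.Adj v v' then g v - g v' else 0) =
      ∑ v, ∑ v', (if H.Adj v v' then g v * (g v - g v') else 0) := by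
    simp only [Finset.mul_sum, mul_ite, mul_zero]
  have h' : ∑ v, ∑ v', (if H.Adj v v' then g v * (g v - g v') else 0) =
      ∑ v, ∑ v', (if H.Adj v v' then g v' * (g v' - g v) else 0) := by
    rw [Finset.sum_comm]
    refine Finset.sum_congr rfl fun v _ => Finset.sum_congr rfl fun v' _ => ?_
    simp only [H.adj_comm v' v]
  rw [two_mul, h]
  nth_rewrite 2 [h']
  simp only [← Finset.sum_add_distrib]
  refine Finset.sum_congr rfl fun v _ => Finset.sum_congr rfl fun v' _ => ?_
  split_ifs <;> ring

variable [DecidableEq V]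

/-- Pairing the equation with `g` shows that the Dirichlet energy plus the killing energy equals `g
b`, so a single edge contributes at most `g b`. The energy sums over ordered pairs, so the edge is
counted in both directions to absorb the factor `2`. -/
theorem abs_sub_le_sqrt_of_killedLaplacian_eq_single (hκ : 0 < κ) {b : V} {g : V → ℝ}
    (hg : H.killedLaplacian D κ g = Pi.single b 1) {v v' : V} (h : H.Adj v v') :
    |g v - g v'| ≤ √(g b) := by
  have h1 : ∑ a, g a * H.killedLaplacian D κ g a = g b := by
    rw [hg]; simp [Pi.single_apply]
  simp only [killedLaplacian_apply, mul_add, Finset.sum_add_distrib] at h1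
  have h2 : 0 ≤ ∑ a, g a * (if D a then κ * g a else 0) := by
    refine Finset.sum_nonneg fun a _ => ?_
    split_ifs
    · have := mul_nonneg hκ.le (mul_self_nonneg (g a)); linarith
    · simp
  have h3 := H.sum_mul_adj_sub g
  have hnn : ∀ a c : V, 0 ≤ (if H.Adj a c then (g a - g c) ^ 2 else 0) := by
    intro a c; split_ifs <;> positivity
  have h4 : (g v - g v') ^ 2 + (g v' - g v) ^ 2 ≤
      ∑ a, ∑ c, (if H.Adj a c then (g a - g c) ^ 2 else 0) := by
    have e1 : (g v - g v') ^ 2 ≤ ∑ c, (if H.Adj v c then (g v - g c) ^ 2 else 0) := by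
      refine le_trans (by rw [if_pos h])
        (Finset.single_le_sum (fun c _ => hnn v c) (Finset.mem_univ v'))
    have e2 : (g v' - g v) ^ 2 ≤ ∑ c, (if H.Adj v' c then (g v' - g c) ^ 2 else 0) := by
      refine le_trans (by rw [if_pos h.symm])
        (Finset.single_le_sum (fun c _ => hnn v' c) (Finset.mem_univ v))
    refine (add_le_add e1 e2).trans ?_
    rw [← Finset.sum_pair (f := fun a => ∑ c, (if H.Adj a c then (g a - g c) ^ 2 else 0)) h.ne]
    exact Finset.sum_le_sum_of_subset_of_nonneg (Finset.subset_univ _)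
      fun a _ _ => Finset.sum_nonneg fun c _ => hnn a c
  refine Real.le_sqrt_of_sq_le ?_
  rw [sq_abs]
  have : (g v' - g v) ^ 2 = (g v - g v') ^ 2 := by ring
  linarith

/-- Conservation of current: summed over all vertices, the edge terms cancel and the total killing
equals the unit injected at `b`. -/
theorem mul_apply_le_one_of_killedLaplacian_eq_single (hκ : 0 < κ) {b : V} {g : V → ℝ}
    (hg : H.killedLaplacian D κ g = Pi.single b 1) (hg0 : ∀ v, 0 ≤ g v) {x : V} (hx : D x) :
    κ * g x ≤ 1 := by
  have h1 : ∑ a, H.killedLaplacian D κ g a = 1 := by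
    rw [hg]; simp [Pi.single_apply]
  simp only [killedLaplacian_apply, Finset.sum_add_distrib, sum_adj_sub_eq_zero, add_zero] at h1
  rw [← h1]
  refine le_trans (by rw [if_pos hx]) (Finset.single_le_sum (fun a _ => ?_) (Finset.mem_univ x))
  have := mul_nonneg hκ.le (hg0 a)
  split_ifs <;> [exact this; exact le_rfl]

/-- The voltage of a unit current entering at `b` and leaving at `x` through a resistor of
conductance `κ`, on the component of `x`; it is at most quadratic in the number of vertices. -/
theorem exists_voltage (hκ : 0 < κ) {x b : V} (hxb : H.Reachable x b) :
    ∃ g : V → ℝ, (∀ v, 0 ≤ g v) ∧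
      (∀ v, g v ≤ (1 + 2 / κ) * (Fintype.card V : ℝ) ^ 2) ∧
      ∀ v, ∑ v', (if H.Adj v v' then g v' - g v else 0) =
        (if v = x then κ * g x else 0) - (if v = b then 1 else 0) := by
  classical
  -- Vertices outside the component of `x` are killed too, so that every component meets `D` and the
  -- operator is invertible.
  set D : V → Prop := fun v => v = x ∨ ¬ H.Reachable x v with hDdef
  have hD : ∀ v, ∃ d, D d ∧ H.Reachable v d := by
    intro v
    by_cases h : H.Reachable x v
    · exact ⟨x, Or.inl rfl, h.symm⟩
    · exact ⟨v, Or.inr h, Reachable.refl v⟩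
  obtain ⟨g, hg⟩ := H.exists_killedLaplacian_eq D hκ hD (Pi.single b 1)
  have hg0 : ∀ v, 0 ≤ g v := by
    refine H.nonneg_of_killedLaplacian_nonneg D hκ hD fun v => ?_
    rw [hg, Pi.single_apply]
    split_ifs <;> norm_num
  have hgx : g x ≤ 1 / κ := by
    rw [le_div_iff₀ hκ, mul_comm]
    exact H.mul_apply_le_one_of_killedLaplacian_eq_single D hκ hg hg0 (Or.inl rfl)
  set s := √(g b) with hs
  have hs0 : 0 ≤ s := Real.sqrt_nonneg _
  have hwalk : ∀ {a c : V} (q : H.Walk a c), g c ≤ g a + q.length * s := by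
    intro a c q
    induction q with
    | nil => simp
    | cons h q ih =>
      have := (abs_le.1 (H.abs_sub_le_sqrt_of_killedLaplacian_eq_single D hκ hg h)).1
      rw [Walk.length_cons]
      push_cast
      linarith
  set n : ℝ := (Fintype.card V : ℝ) with hn
  have hn1 : 1 ≤ n := by
    have : 0 < Fintype.card V := Fintype.card_pos_iff.2 ⟨x⟩
    rw [hn]; exact_mod_cast this
  have hreach : ∀ v, H.Reachable x v → g v ≤ 1 / κ + n * s := by
    rintro v ⟨q⟩
    have h1 := hwalk q.bypass
    have h2 : (q.bypass.length : ℝ) ≤ n := by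
      rw [hn]; exact_mod_cast (q.bypass_isPath.length_lt).le
    have := mul_le_mul_of_nonneg_right h2 hs0
    linarith
  have hk : 0 < 1 / κ := by positivity
  -- Here `s ^ 2 = g b ≤ 1 / κ + n * s`; if `s > n + 1 / κ`, then `s > 1` and `s ^ 2 > n * s + 1 /
  -- κ`.
  have hsn : s ≤ n + 1 / κ := by
    have h1 := hreach b hxb
    have h2 : s ^ 2 = g b := Real.sq_sqrt (hg0 b)
    by_contra! h
    nlinarith
  -- Setting `g` to zero off the component of `x` removes the auxiliary killing and alters no
  -- difference across an edge.
  refine ⟨fun v => if H.Reachable x v then g v else 0, fun v => ?_, fun v => ?_, fun v => ?_⟩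
  · dsimp only
    split_ifs <;> [exact hg0 v; exact le_rfl]
  · dsimp only
    have e : 2 / κ = 2 * (1 / κ) := by ring
    rw [e]
    split_ifs with h
    · have h1 := hreach v h
      have h2 : n * s ≤ n * (n + 1 / κ) := mul_le_mul_of_nonneg_left hsn (by linarith)
      have h3 : 1 / κ ≤ 1 / κ * n ^ 2 := le_mul_of_one_le_right hk.le (one_le_pow₀ hn1)
      have h4 : 1 / κ * n ≤ 1 / κ * n ^ 2 :=
        mul_le_mul_of_nonneg_left (le_self_pow₀ hn1 two_ne_zero) hk.le
      linarith
    · positivity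
  · by_cases h : H.Reachable x v
    · have h1 := congrFun hg v
      rw [killedLaplacian_apply, Pi.single_apply] at h1
      have h2 : ∑ v', (if H.Adj v v' then (if H.Reachable x v' then g v' else 0) -
          (if H.Reachable x v then g v else 0) else 0) =
          - ∑ v', (if H.Adj v v' then g v - g v' else 0) := by
        rw [← Finset.sum_neg_distrib]
        refine Finset.sum_congr rfl fun v' _ => ?_
        split_ifs with h3 h4
        · ring
        · exact absurd (h.trans h3.reachable) h4
        · ring
      rw [h2]
      have h3 : (if D v then κ * g v else 0) =
          if v = x then κ * (if H.Reachable x x then g x else 0) else 0 := by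
        by_cases hvx : v = x
        · subst hvx; simp [hDdef]
        · simp [hDdef, hvx, h]
      rw [← h3]
      linarith
    · have hvx : v ≠ x := by rintro rfl; exact h (Reachable.refl _)
      have hvb : v ≠ b := by rintro rfl; exact h hxb
      rw [if_neg hvx, if_neg hvb, sub_zero]
      refine Finset.sum_eq_zero fun v' _ => ?_
      simp only [if_neg h]
      split_ifs with h3 h4
      · exact absurd (h4.trans h3.symm.reachable) h
      · simp
      · rfl

/-- A walk from `x` to a vertex outside `A` must leave the component of `x` in `A`, and the edge by
which it leaves cannot end in `A`. -/
theorem Connected.exists_reachable_adj_notMem {G : SimpleGraph V} (hG : G.Connected)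
    {A : Finset V} {x : V} (hx : x ∈ A) (hA : A ≠ Finset.univ) :
    ∃ b ∈ A, (G.induce (A : Set V)).spanningCoe.Reachable x b ∧ ∃ u ∉ A, G.Adj u b := by
  obtain ⟨y, hy⟩ : ∃ y, y ∉ A := by
    by_contra! h
    exact hA (Finset.eq_univ_iff_forall.2 h)
  obtain ⟨q⟩ := hG.preconnected x y
  have hsub : ∀ v, (G.induce (A : Set V)).spanningCoe.Reachable x v → v ∈ A := by
    rintro v ⟨r⟩
    induction r using Walk.concatRec with
    | Hnil => exact hx
    | Hconcat r h _ => exact (adj_spanningCoe_induce_iff.1 h).2.2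
  obtain ⟨d, -, h1, h2⟩ := q.exists_boundary_dart
    {v | (G.induce (A : Set V)).spanningCoe.Reachable x v} (Reachable.refl x)
    fun h => hy (hsub y h)
  refine ⟨d.fst, hsub _ h1, h1, d.snd, fun h => h2 ?_, d.adj.symm⟩
  exact Reachable.trans h1
    (adj_spanningCoe_induce_iff.2 ⟨d.adj, hsub _ h1, h⟩ : Adj _ d.fst d.snd).reachable

/-- For every vertex set `A ∋ x` other than the whole graph, the voltage on `A` for a current from a
vertex `b` with a neighbor outside `A` to `x`. -/
theorem Connected.exists_voltage_of_mem {G : SimpleGraph V} [DecidableRel G.Adj]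
    (hG : G.Connected) (hκ : 0 < κ) (x : V) : ∃ g : Finset V → V → ℝ, (∀ A v, 0 ≤ g A v) ∧
      (∀ A v, g A v ≤ (1 + 2 / κ) * (Fintype.card V : ℝ) ^ 2) ∧
      ∀ A, x ∈ A → A ≠ Finset.univ → ∃ b ∈ A, (∃ u ∉ A, G.Adj u b) ∧
        ∀ v ∈ A, ∑ v' ∈ A, (if G.Adj v v' then g A v' - g A v else 0) =
          (if v = x then κ * g A x else 0) - (if v = b then 1 else 0) := by
  have key : ∀ A : Finset V, ∃ g : V → ℝ, (∀ v, 0 ≤ g v) ∧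
      (∀ v, g v ≤ (1 + 2 / κ) * (Fintype.card V : ℝ) ^ 2) ∧
      (x ∈ A → A ≠ Finset.univ → ∃ b ∈ A, (∃ u ∉ A, G.Adj u b) ∧
        ∀ v ∈ A, ∑ v' ∈ A, (if G.Adj v v' then g v' - g v else 0) =
          (if v = x then κ * g x else 0) - (if v = b then 1 else 0)) := by
    classical
    intro A
    by_cases h : x ∈ A ∧ A ≠ Finset.univ
    · obtain ⟨b, hb, hxb, hu⟩ := hG.exists_reachable_adj_notMem h.1 h.2
      obtain ⟨g, h0, h1, h2⟩ := exists_voltage _ hκ hxb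
      refine ⟨g, h0, h1, fun _ _ => ⟨b, hb, hu, fun v hv => ?_⟩⟩
      rw [← h2 v]
      simp only [adj_spanningCoe_induce_iff, hv, true_and]
      rw [← Finset.sum_filter_add_sum_filter_not Finset.univ (· ∈ A)]
      rw [Finset.sum_eq_zero (s := Finset.univ.filter (· ∉ A)), add_zero]
      · refine Finset.sum_congr (by ext; simp) fun v' hv' => ?_
        rw [Finset.mem_filter] at hv'
        simp [hv'.2]
      · intro v' hv'
        simp only [Finset.mem_filter] at hv'
        simp [hv'.2]
    · exact ⟨0, fun _ => le_rfl, fun _ => by simp only [Pi.zero_apply]; positivity,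
        fun h1 h2 => absurd ⟨h1, h2⟩ h⟩
  choose g h0 h1 h2 using key
  exact ⟨g, h0, h1, h2⟩

end SimpleGraph

/-! ### One-step expectations of the algorithm -/

section ExpectActivate

variable {V : Type*} [Fintype V] [DecidableEq V] (G : SimpleGraph V) [DecidableRel G.Adj]
  {Δ : ℕ} {p : ℝ} (sel : AgentConfig V → V → PMF V) {W : Finset V} {u : V} {σ : AgentConfig V}
  (f : AgentConfig V → ℝ)

theorem expect_activate_of_mem_of_not_flag (hp0 : 0 ≤ p) (hp1 : p ≤ 1) (hu : u ∈ W)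
    (hf : (σ u).hasWitnessFlag = false) : (activate G Δ p sel W u σ).expect f =
      p * f (Function.update σ u .awareW) + (1 - p) * f σ := by
  rw [activate, if_pos (by simp [hu, hf]), PMF.expect_bind]
  simp [PMF.expect_pure, PMF.expect_coin hp0 hp1]

theorem expect_activate_of_notMem_of_flag (hu : u ∉ W) (hf : (σ u).hasWitnessFlag = true) :
    (activate G Δ p sel W u σ).expect f = f (broadcastClear G u σ) := by
  rw [activate, if_neg (by simp [hu]), if_pos (by simp [hu, hf]), PMF.expect_pure]

theorem activate_of_unaware (hu : u ∉ W) (hf : σ u = .unaware)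
    (hv : ∃ v, IsAlertNeighbor G σ u v) :
    activate G Δ p sel W u σ = (sel σ u).bind fun v => PMF.pure (consumeAlert u v σ) := by
  rw [activate, if_neg (by simp [hu]), if_neg (by simp [hf, AgentState.hasWitnessFlag]), hf]
  simp only
  rw [if_pos hv]

theorem activate_of_unaware_of_not (hu : u ∉ W) (hf : σ u = .unaware)
    (hv : ¬ ∃ v, IsAlertNeighbor G σ u v) :
    activate G Δ p sel W u σ = PMF.pure σ := by
  rw [activate, if_neg (by simp [hu]), if_neg (by simp [hf, AgentState.hasWitnessFlag]), hf]
  simp only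
  rw [if_neg hv]

theorem activate_of_aware (hu : u ∉ W) (hf : σ u = .aware) :
    activate G Δ p sel W u σ = PMF.pure σ := by
  rw [activate, if_neg (by simp [hu]), if_neg (by simp [hf, AgentState.hasWitnessFlag]), hf]

theorem activate_of_awareC (hu : u ∉ W) (hf : σ u = .awareC) :
    activate G Δ p sel W u σ = PMF.pure (broadcastClear G u σ) := by
  rw [activate, if_neg (by simp [hu]), if_neg (by simp [hf, AgentState.hasWitnessFlag]), hf]

theorem activate_of_awareW (hu : u ∈ W) (hf : σ u = .awareW) :
    activate G Δ p sel W u σ =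
      (coin p).bind fun b => PMF.pure (if b then Function.update σ u .awareAW else σ) := by
  rw [activate, if_neg (by simp [hf, AgentState.hasWitnessFlag]), if_neg (by simp [hu]), hf]

theorem expect_activate_of_awareW (hp0 : 0 ≤ p) (hp1 : p ≤ 1) (hu : u ∈ W) (hf : σ u = .awareW) :
    (activate G Δ p sel W u σ).expect f =
      p * f (Function.update σ u .awareAW) + (1 - p) * f σ := by
  rw [activate_of_awareW G sel hu hf, PMF.expect_bind]
  simp [PMF.expect_pure, PMF.expect_coin hp0 hp1]

theorem activate_of_hasAlert (hu : u ∈ W ↔ (σ u).hasWitnessFlag = true)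
    (hf : (σ u).hasAlert = true) : activate G Δ p sel W u σ =
      if h : (G.neighborFinset u).Nonempty then
        (coin ((G.degree u : ℝ) / (Δ : ℝ))).bind fun b =>
          if b then
            (PMF.uniformOfFinset (G.neighborFinset u) h).bind fun v =>
              PMF.pure (passAlert u v σ)
          else PMF.pure σ
      else PMF.pure σ := by
  rw [activate, if_neg (by simp [hu]), if_neg (by simp [hu])]
  cases h : σ u <;> simp_all [AgentState.hasAlert]

/-- A coin of bias `deg u / Δ` followed by a uniform neighbor picks each neighbor with probability
`1 / Δ`. The assumption `hu` says that neither of the first two rules applies. -/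
theorem expect_activate_of_hasAlert (hu : u ∈ W ↔ (σ u).hasWitnessFlag = true)
    (hf : (σ u).hasAlert = true) (hΔ : 0 < Δ) (hdeg : G.degree u ≤ Δ) :
    (activate G Δ p sel W u σ).expect f =
      f σ + (Δ : ℝ)⁻¹ * ∑ v, if G.Adj u v then f (passAlert u v σ) - f σ else 0 := by
  have hsum : (∑ v, if G.Adj u v then f (passAlert u v σ) - f σ else 0) =
      ∑ v ∈ G.neighborFinset u, (f (passAlert u v σ) - f σ) := by
    rw [← Finset.sum_filter]
    congr 1
    ext v
    simp
  rw [hsum, activate_of_hasAlert G sel hu hf]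
  have hΔ' : (0 : ℝ) < Δ := by exact_mod_cast hΔ
  split_ifs with h
  · have hd : (0 : ℝ) < G.degree u := by
      exact_mod_cast Finset.card_pos.2 h
    rw [PMF.expect_bind, PMF.expect_coin (by positivity)
      (by rw [div_le_one hΔ']; exact_mod_cast hdeg)]
    simp only [if_true, Bool.false_eq_true, if_false]
    rw [PMF.expect_bind, PMF.expect_uniformOfFinset]
    simp only [PMF.expect_pure, Finset.sum_sub_distrib, Finset.sum_const,
      SimpleGraph.card_neighborFinset_eq_degree, nsmul_eq_mul]
    field_simp
    ring
  · rw [Finset.not_nonempty_iff_eq_empty] at h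
    simp [h, PMF.expect_pure]

/-- Reduces a unit drift per iteration to a bound on the changes `d u` per activated agent; their
average carries the factor `1 / n`, so their sum must be at most `-n`. -/
theorem expect_iteration_le [Nonempty V] {d : V → ℝ}
    (hd : ∀ u, (activate G Δ p sel W u σ).expect f ≤ f σ + d u)
    (hsum : ∑ u, d u ≤ -(Fintype.card V : ℝ)) :
    (iteration G Δ p sel W σ).expect f + 1 ≤ f σ := by
  rw [iteration, PMF.expect_bind, PMF.expect_uniformOfFintype]
  have hn : (0 : ℝ) < Fintype.card V := by exact_mod_cast Fintype.card_pos
  have h : ∑ u, (activate G Δ p sel W u σ).expect f ≤ Fintype.card V * (f σ - 1) := by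
    refine (Finset.sum_le_sum fun u _ => hd u).trans ?_
    rw [Finset.sum_add_distrib]
    simp only [Finset.sum_const, Finset.card_univ, nsmul_eq_mul]
    linarith
  have := mul_le_mul_of_nonneg_left h (inv_nonneg.2 hn.le)
  rw [inv_mul_cancel_left₀ hn.ne'] at this
  linarith

end ExpectActivate

/-! ### Absence of residual agents is preserved -/

section Residual

variable {V : Type*} [Fintype V] [DecidableEq V] (G : SimpleGraph V) [DecidableRel G.Adj]
  {Δ : ℕ} {p : ℝ} (sel : AgentConfig V → V → PMF V) {W : Finset V} {u : V} {σ σ' : AgentConfig V}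

/-- No agent outside `W` carries a witness flag or an all-clear token. -/
def NoResidual (W : Finset V) (σ : AgentConfig V) : Prop :=
  ∀ v, v ∉ W → (σ v).hasWitnessFlag = false ∧ (σ v).hasClear = false

/-- The transition from `σ` to `σ'` creates no residual agents and removes no witness flag and no
awareness. -/
structure IsMonotoneStep (W : Finset V) (σ σ' : AgentConfig V) : Prop where
  noResidual : NoResidual W σ'
  flag : ∀ v, (σ v).hasWitnessFlag = true → (σ' v).hasWitnessFlag = true
  aware : ∀ v, (σ v).isAware = true → (σ' v).isAware = true

theorem isMonotoneStep_of_forall {V : Type*} {W : Finset V} {σ σ' : AgentConfig V}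
    (h : NoResidual W σ)
    (hv : ∀ v, σ' v = σ v ∨
      (((σ v).hasWitnessFlag = true → (σ' v).hasWitnessFlag = true) ∧ (σ' v).isAware = true ∧
        (v ∉ W → (σ' v).hasWitnessFlag = false ∧ (σ' v).hasClear = false))) :
    IsMonotoneStep W σ σ' := by
  refine ⟨fun v hvW => ?_, fun v hf => ?_, fun v hf => ?_⟩
  · rcases hv v with e | e
    · rw [e]; exact h v hvW
    · exact e.2.2 hvW
  · rcases hv v with e | e
    · rw [e]; exact hf
    · exact e.1 hf
  · rcases hv v with e | e
    · rw [e]; exact hf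
    · exact e.2.1

theorem isMonotoneStep_consumeAlert {V : Type*} [DecidableEq V] {W : Finset V} {u : V}
    {σ : AgentConfig V} (h : NoResidual W σ) (hu : u ∉ W) {v : V}
    (hv : (σ v).hasAlert = true) : IsMonotoneStep W σ (consumeAlert u v σ) := by
  refine isMonotoneStep_of_forall h fun a => ?_
  unfold consumeAlert
  by_cases ha : a = u
  · subst ha
    refine Or.inr ⟨fun hf => ?_, ?_⟩
    · simp [(h a hu).1] at hf
    · simp [AgentState.isAware, AgentState.hasWitnessFlag, AgentState.hasClear]
  · by_cases hav : a = v
    · subst hav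
      right
      have := h a
      rw [Function.update_of_ne ha, Function.update_self]
      cases e : σ a <;> simp_all [AgentState.isAware, AgentState.hasWitnessFlag,
        AgentState.hasClear, AgentState.dropAlert, AgentState.hasAlert]
    · left; simp [ha, hav]

theorem isMonotoneStep_passAlert {V : Type*} [DecidableEq V] {W : Finset V} {u : V}
    {σ : AgentConfig V} (h : NoResidual W σ) {v : V} (huv : u ≠ v)
    (hu : (σ u).hasAlert = true) : IsMonotoneStep W σ (passAlert u v σ) := by
  refine isMonotoneStep_of_forall h fun a => ?_
  unfold passAlert
  split_ifs with hc
  · by_cases ha : a = v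
    · subst ha
      right
      have := h a
      rw [Function.update_self]
      cases e : σ a <;> simp_all [AgentState.isAware, AgentState.hasWitnessFlag,
        AgentState.hasClear, AgentState.addAlert, AgentState.canReceiveAlert]
    · by_cases hau : a = u
      · subst hau
        right
        have := h a
        rw [Function.update_of_ne ha, Function.update_self]
        cases e : σ a <;> simp_all [AgentState.isAware, AgentState.hasWitnessFlag,
          AgentState.hasClear, AgentState.dropAlert, AgentState.hasAlert]
      · left; simp [ha, hau]
  · exact Or.inl rfl

theorem isMonotoneStep_update {V : Type*} [DecidableEq V] {W : Finset V} {u : V}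
    {σ : AgentConfig V} (h : NoResidual W σ) (hu : u ∈ W) {s : AgentState}
    (hs : s.hasWitnessFlag = true) : IsMonotoneStep W σ (Function.update σ u s) := by
  refine isMonotoneStep_of_forall h fun a => ?_
  by_cases ha : a = u
  · subst ha
    right
    cases s <;> simp_all [AgentState.isAware, AgentState.hasWitnessFlag]
  · left; simp [ha]

/-- Only a residual agent can broadcast the all-clear: an agent of `W` in state `awareC` falls under
the first rule instead. Every other action keeps flags and awareness and creates flags only inside
`W`. -/
theorem isMonotoneStep_of_mem_support_activate (hsel : IsSelectionRule G sel)
    (h : NoResidual W σ) (hσ' : σ' ∈ (activate G Δ p sel W u σ).support) :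
    IsMonotoneStep W σ σ' := by
  have hrefl : IsMonotoneStep W σ σ := isMonotoneStep_of_forall h fun _ => Or.inl rfl
  have hcoin : ∀ s : AgentState, s.hasWitnessFlag = true → u ∈ W →
      σ' ∈ ((coin p).bind fun b => PMF.pure (if b then Function.update σ u s else σ)).support →
      IsMonotoneStep W σ σ' := by
    intro s hs hu hσ'
    rw [PMF.mem_support_bind_iff] at hσ'
    obtain ⟨b, -, hb⟩ := hσ'
    rw [PMF.mem_support_pure_iff] at hb
    subst hb
    split_ifs
    · exact isMonotoneStep_update h hu hs
    · exact hrefl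
  have halert : (u ∈ W ↔ (σ u).hasWitnessFlag = true) → (σ u).hasAlert = true →
      IsMonotoneStep W σ σ' := by
    intro hu ha
    rw [activate_of_hasAlert G sel hu ha] at hσ'
    split_ifs at hσ' with hne
    · rw [PMF.mem_support_bind_iff] at hσ'
      obtain ⟨b, -, hb⟩ := hσ'
      split_ifs at hb
      · rw [PMF.mem_support_bind_iff] at hb
        obtain ⟨v, hv, hb⟩ := hb
        rw [PMF.mem_support_pure_iff] at hb
        rw [PMF.mem_support_uniformOfFinset_iff, SimpleGraph.mem_neighborFinset] at hv
        subst hb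
        exact isMonotoneStep_passAlert h hv.ne ha
      · rw [PMF.mem_support_pure_iff] at hb
        exact hb ▸ hrefl
    · rw [PMF.mem_support_pure_iff] at hσ'
      exact hσ' ▸ hrefl
  by_cases hu : u ∈ W
  · cases hf : (σ u).hasWitnessFlag with
    | false =>
      rw [activate, if_pos (by simp [hu, hf])] at hσ'
      exact hcoin _ rfl hu hσ'
    | true =>
      by_cases ha : (σ u).hasAlert = true
      · exact halert (by simp [hu, hf]) ha
      · have : σ u = .awareW := by
          cases e : σ u <;> simp_all [AgentState.hasWitnessFlag, AgentState.hasAlert]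
        rw [activate_of_awareW G sel hu this] at hσ'
        exact hcoin _ rfl hu hσ'
  · obtain ⟨hf, hc⟩ := h u hu
    by_cases ha : (σ u).hasAlert = true
    · exact halert (by simp [hu, hf]) ha
    · by_cases hv : ∃ v, IsAlertNeighbor G σ u v
      · by_cases hU : σ u = .unaware
        · rw [activate_of_unaware G sel hu hU hv, PMF.mem_support_bind_iff] at hσ'
          obtain ⟨v, hv', hb⟩ := hσ'
          rw [PMF.mem_support_pure_iff] at hb
          subst hb
          exact isMonotoneStep_consumeAlert h hu (hsel σ u hv v hv').2
        · have : σ u = .aware := by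
            cases e : σ u <;> simp_all [AgentState.hasWitnessFlag, AgentState.hasAlert,
              AgentState.hasClear]
          rw [activate_of_aware G sel hu this, PMF.mem_support_pure_iff] at hσ'
          exact hσ' ▸ hrefl
      · have : σ u = .aware ∨ σ u = .unaware := by
          cases e : σ u <;> simp_all [AgentState.hasWitnessFlag, AgentState.hasAlert,
            AgentState.hasClear]
        have e : activate G Δ p sel W u σ = PMF.pure σ := by
          rcases this with e | e
          · exact activate_of_aware G sel hu e
          · exact activate_of_unaware_of_not G sel hu e hv
        rw [e, PMF.mem_support_pure_iff] at hσ'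
        exact hσ' ▸ hrefl

end Residual

/-! ### Drift of the total weight, which removes residual agents -/

section Weight

variable {V : Type*} [Fintype V] [DecidableEq V] (G : SimpleGraph V) [DecidableRel G.Adj]
  {Δ : ℕ} {p : ℝ} (sel : AgentConfig V → V → PMF V) {W : Finset V} {u : V}

/-- The contribution of an agent to the number of aware agents plus the number of alert tokens. -/
def AgentState.weight : AgentState → ℝ
  | unaware => 0
  | awareA => 2
  | awareAW => 2
  | _ => 1

/-- The number of aware agents plus the number of alert tokens. -/
noncomputable def totalWeight (σ : AgentConfig V) : ℝ := ∑ v, (σ v).weight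

theorem AgentState.weight_nonneg (s : AgentState) : 0 ≤ s.weight := by
  cases s <;> norm_num [AgentState.weight]

theorem AgentState.weight_le_two (s : AgentState) : s.weight ≤ 2 := by
  cases s <;> norm_num [AgentState.weight]

theorem totalWeight_nonneg {V : Type*} [Fintype V] (σ : AgentConfig V) :
    0 ≤ totalWeight σ :=
  Finset.sum_nonneg fun v _ => (σ v).weight_nonneg

theorem totalWeight_le {V : Type*} [Fintype V] (σ : AgentConfig V) :
    totalWeight σ ≤ 2 * Fintype.card V := by
  refine (Finset.sum_le_sum fun v _ => (σ v).weight_le_two).trans_eq ?_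
  simp [mul_comm]

variable (σ : AgentConfig V)

theorem totalWeight_update (s : AgentState) :
    totalWeight (Function.update σ u s) = totalWeight σ + (s.weight - (σ u).weight) := by
  rw [← sub_eq_iff_eq_add', totalWeight, totalWeight, ← Finset.sum_sub_distrib,
    Fintype.sum_eq_single u]
  · simp
  · intro v hv
    simp [hv]

theorem totalWeight_update_update {v : V} (huv : u ≠ v) (s t : AgentState) :
    totalWeight (Function.update (Function.update σ u s) v t) =
      totalWeight σ + (s.weight - (σ u).weight) + (t.weight - (σ v).weight) := by
  rw [totalWeight_update, totalWeight_update, Function.update_of_ne huv.symm]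

theorem totalWeight_consumeAlert_le {v : V} (hu : σ u = .unaware) (hv : (σ v).hasAlert = true) :
    totalWeight (consumeAlert u v σ) ≤ totalWeight σ := by
  have huv : v ≠ u := by rintro rfl; simp [hu, AgentState.hasAlert] at hv
  rw [consumeAlert, totalWeight_update_update σ huv, hu]
  cases e : σ v <;>
    simp_all [AgentState.weight, AgentState.hasAlert, AgentState.dropAlert] <;> norm_num

theorem totalWeight_passAlert_le {v : V} (huv : u ≠ v) (hu : (σ u).hasAlert = true) :
    totalWeight (passAlert u v σ) ≤ totalWeight σ := by
  rw [passAlert]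
  split_ifs with hv
  · rw [totalWeight_update_update σ huv]
    cases e : σ v <;> cases e' : σ u <;>
      simp_all [AgentState.weight, AgentState.hasAlert, AgentState.dropAlert,
        AgentState.addAlert, AgentState.canReceiveAlert] <;> norm_num
  · exact le_rfl

theorem totalWeight_broadcastClear_le (hu : (σ u).isAware = true) :
    totalWeight (broadcastClear G u σ) ≤ totalWeight σ - 1 := by
  have h : ∀ v, (broadcastClear G u σ v).weight ≤ (σ v).weight - if v = u then 1 else 0 := by
    intro v
    unfold broadcastClear
    by_cases hv : v = u
    · subst hv
      cases e : σ v <;> simp_all [AgentState.weight, AgentState.isAware]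
    · simp only [hv, if_false]
      split_ifs with ha
      · have := ha.2
        cases e : σ v <;> simp_all [AgentState.weight, AgentState.isAware]
      · simp
  refine (Finset.sum_le_sum fun v _ => h v).trans_eq ?_
  simp [totalWeight]

/-- Passing or consuming a token does not increase the weight, since a consumed token pays for the
new aware agent. Only a witness can raise it, by at most one and with probability at most `p`, while
a broadcast removes the weight of `u`, which is at least one. -/
theorem expect_activate_totalWeight_le (hp0 : 0 ≤ p) (hp1 : p ≤ 1) (hΔ : 0 < Δ)
    (hdeg : G.degree u ≤ Δ) (hsel : IsSelectionRule G sel) :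
    (activate G Δ p sel W u σ).expect totalWeight ≤ totalWeight σ + ((if u ∈ W then p else 0) -
      if u ∉ W ∧ ((σ u).hasWitnessFlag = true ∨ (σ u).hasClear = true) then 1 else 0) := by
  have halert : (u ∈ W ↔ (σ u).hasWitnessFlag = true) → (σ u).hasAlert = true →
      (activate G Δ p sel W u σ).expect totalWeight ≤ totalWeight σ := by
    intro hu ha
    rw [expect_activate_of_hasAlert G sel _ hu ha hΔ hdeg]
    have : (∑ v, if G.Adj u v then totalWeight (passAlert u v σ) - totalWeight σ else 0) ≤ 0 := by
      refine Finset.sum_nonpos fun v _ => ?_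
      split_ifs with huv
      · linarith [totalWeight_passAlert_le σ huv.ne ha]
      · exact le_rfl
    have := mul_nonpos_of_nonneg_of_nonpos (inv_nonneg.2 (Nat.cast_nonneg' (α := ℝ) Δ)) this
    linarith
  by_cases hu : u ∈ W
  · simp only [hu, if_true, not_true, false_and, if_false, sub_zero]
    cases hf : (σ u).hasWitnessFlag with
    | false =>
      rw [expect_activate_of_mem_of_not_flag G sel _ hp0 hp1 hu hf, totalWeight_update]
      have h1 : AgentState.awareW.weight = 1 := rfl
      have := mul_nonneg hp0 (σ u).weight_nonneg
      rw [h1]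
      linarith
    | true =>
      by_cases ha : (σ u).hasAlert = true
      · linarith [halert (by simp [hu, hf]) ha]
      · have e : σ u = .awareW := by
          cases e : σ u <;> simp_all [AgentState.hasWitnessFlag, AgentState.hasAlert]
        rw [expect_activate_of_awareW G sel _ hp0 hp1 hu e, totalWeight_update, e]
        have h1 : AgentState.awareW.weight = 1 := rfl
        have h2 : AgentState.awareAW.weight = 2 := rfl
        rw [h1, h2]
        linarith
  · simp only [hu, if_false, not_false_iff, true_and, zero_sub]
    cases hf : (σ u).hasWitnessFlag with
    | true =>
      rw [expect_activate_of_notMem_of_flag G sel _ hu hf]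
      simp only [true_or, if_true]
      exact totalWeight_broadcastClear_le G σ (by
        cases e : σ u <;> simp_all [AgentState.hasWitnessFlag, AgentState.isAware])
    | false =>
      cases e : σ u with
      | unaware =>
        simp only [AgentState.hasClear, Bool.false_eq_true, or_self, if_false, neg_zero, add_zero]
        by_cases hv : ∃ v, IsAlertNeighbor G σ u v
        · rw [activate_of_unaware G sel hu e hv, PMF.expect_bind]
          refine PMF.expect_le_const _ fun v hv' => ?_
          rw [PMF.expect_pure]
          exact totalWeight_consumeAlert_le σ e (hsel σ u hv v hv').2
        · rw [activate_of_unaware_of_not G sel hu e hv, PMF.expect_pure]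
      | aware =>
        rw [activate_of_aware G sel hu e, PMF.expect_pure]
        simp [AgentState.hasClear]
      | awareA =>
        simpa [AgentState.hasClear] using
          halert (by simp [hu, hf]) (by simp [e, AgentState.hasAlert])
      | awareC =>
        rw [activate_of_awareC G sel hu e, PMF.expect_pure]
        simpa [AgentState.hasClear, ← sub_eq_add_neg] using
          totalWeight_broadcastClear_le G σ (u := u) (by simp [e, AgentState.isAware])
      | awareW => simp [e, AgentState.hasWitnessFlag] at hf
      | awareAW => simp [e, AgentState.hasWitnessFlag] at hf

end Weight

/-! ### Vacancies as an exclusion process and the alert potential -/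

section AlertPotential

variable {V : Type*} [Fintype V]

/-- The set of aware agents. -/
def awareSet (σ : AgentConfig V) : Finset V := Finset.univ.filter fun v => (σ v).isAware = true

theorem mem_awareSet {σ : AgentConfig V} {v : V} : v ∈ awareSet σ ↔ (σ v).isAware = true := by
  simp [awareSet]

/-- The sum of `g` over the aware agents that can receive an alert token. -/
noncomputable def vacancySum (g : V → ℝ) (σ : AgentConfig V) : ℝ :=
  ∑ v, if (σ v).canReceiveAlert = true then g v else 0

theorem vacancySum_nonneg {g : V → ℝ} (hg : ∀ v, 0 ≤ g v) (σ : AgentConfig V) :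
    0 ≤ vacancySum g σ :=
  Finset.sum_nonneg fun v _ => by split_ifs <;> [exact hg v; exact le_rfl]

theorem vacancySum_le {g : V → ℝ} {B : ℝ} (hB : 0 ≤ B) (hg : ∀ v, g v ≤ B) (σ : AgentConfig V) :
    vacancySum g σ ≤ Fintype.card V * B := by
  have : ∀ v, (if (σ v).canReceiveAlert = true then g v else 0) ≤ B := fun v => by
    split_ifs <;> [exact hg v; exact hB]
  refine (Finset.sum_le_sum fun v _ => this v).trans_eq ?_
  simp

/-- The expected change of a linear functional of the vacancies under symmetric exclusion. -/
theorem sum_exclusion_eq (G : SimpleGraph V) [DecidableRel G.Adj] (σ : AgentConfig V)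
    (hC : ∀ v, (σ v).hasClear = false) (g : V → ℝ) :
    (∑ u, if (σ u).hasAlert = true then
      ∑ v, if G.Adj u v then (if (σ v).canReceiveAlert = true then g u - g v else 0) else 0
      else 0) =
    ∑ v, if (σ v).canReceiveAlert = true then
      ∑ u ∈ awareSet σ, if G.Adj v u then g u - g v else 0 else 0 := by
  have h0 : ∑ u, ∑ v, (if (σ u).canReceiveAlert = true ∧ (σ v).canReceiveAlert = true ∧ G.Adj u v
      then g u - g v else 0) = 0 := by
    refine sum_sum_eq_zero_of_antisymm fun u v => ?_
    by_cases h1 : (σ u).canReceiveAlert = true <;> by_cases h2 : (σ v).canReceiveAlert = true <;>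
      by_cases h3 : G.Adj u v <;> simp [h1, h2, h3, G.adj_comm v u]
  have h1 : ∀ v, (if (σ v).canReceiveAlert = true then
      ∑ u ∈ awareSet σ, (if G.Adj v u then g u - g v else 0) else 0) =
      ∑ u, if (σ v).canReceiveAlert = true ∧ (σ u).isAware = true ∧ G.Adj u v
        then g u - g v else 0 := by
    intro v
    rw [awareSet, Finset.sum_filter]
    split_ifs with hv
    · refine Finset.sum_congr rfl fun u _ => ?_
      simp [hv, G.adj_comm v u, ite_and]
    · simp [hv]
  have h2 : ∀ u, (if (σ u).hasAlert = true then
      ∑ v, (if G.Adj u v then (if (σ v).canReceiveAlert = true then g u - g v else 0) else 0)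
      else 0) = ∑ v, if (σ u).hasAlert = true ∧ (σ v).canReceiveAlert = true ∧ G.Adj u v
        then g u - g v else 0 := by
    intro u
    split_ifs with hu
    · refine Finset.sum_congr rfl fun v _ => ?_
      by_cases h : G.Adj u v <;> simp [hu, h]
    · simp [hu]
  simp only [h1, h2]
  have h3 : (∑ v, ∑ u, if (σ v).canReceiveAlert = true ∧ (σ u).isAware = true ∧ G.Adj u v
      then g u - g v else 0) = ∑ u, ∑ v,
        if (σ v).canReceiveAlert = true ∧ (σ u).isAware = true ∧ G.Adj u v
          then g u - g v else 0 := Finset.sum_comm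
  rw [h3]
  -- Jumps between two vacancies are added on the left; their antisymmetric sum vanishes. Without
  -- all-clear tokens an aware agent either holds an alert token or is vacant, so the two sums on
  -- the left together range over all aware `u`.
  refine (add_zero _).symm.trans ((congrArg (_ + ·) h0.symm).trans ?_)
  rw [← Finset.sum_add_distrib]
  refine Finset.sum_congr rfl fun u _ => ?_
  rw [← Finset.sum_add_distrib]
  refine Finset.sum_congr rfl fun v _ => ?_
  have := hC u
  clear h0 h1 h2 h3 hC
  cases e : σ u <;> simp_all [AgentState.hasAlert, AgentState.canReceiveAlert,
    AgentState.isAware, AgentState.hasClear]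

theorem awareSet_eq_univ_iff {σ : AgentConfig V} : awareSet σ = Finset.univ ↔ AllAware σ := by
  simp [Finset.eq_univ_iff_forall, mem_awareSet, AllAware]

variable [DecidableEq V]

/-- A potential that decreases on average as long as no agent becomes unaware: `M` times the
number of unaware agents, plus `c` times the voltages of the vacant aware agents. -/
noncomputable def alertPotential (g : Finset V → V → ℝ) (M c : ℝ) (σ : AgentConfig V) : ℝ :=
  if awareSet σ = Finset.univ then 0
  else M * (awareSet σ)ᶜ.card + c * vacancySum (g (awareSet σ)) σ

theorem awareSet_update {σ : AgentConfig V} {u : V} {s : AgentState}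
    (h : s.isAware = (σ u).isAware) : awareSet (Function.update σ u s) = awareSet σ := by
  ext v
  rw [mem_awareSet, mem_awareSet]
  by_cases hv : v = u
  · subst hv; simp [h]
  · simp [hv]

theorem AgentState.isAware_dropAlert (s : AgentState) : s.dropAlert.isAware = s.isAware := by
  cases s <;> rfl

theorem AgentState.isAware_addAlert (s : AgentState) : s.addAlert.isAware = s.isAware := by
  cases s <;> rfl

theorem awareSet_passAlert {σ : AgentConfig V} {u v : V} (huv : u ≠ v) :
    awareSet (passAlert u v σ) = awareSet σ := by
  unfold passAlert
  split_ifs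
  · rw [awareSet_update, awareSet_update]
    · exact AgentState.isAware_dropAlert _
    · rw [Function.update_of_ne huv.symm, AgentState.isAware_addAlert]
  · rfl

theorem awareSet_consumeAlert {σ : AgentConfig V} {u v : V} (huv : v ≠ u) :
    awareSet (consumeAlert u v σ) = insert u (awareSet σ) := by
  ext a
  rw [Finset.mem_insert, mem_awareSet, mem_awareSet, consumeAlert]
  by_cases ha : a = u
  · subst ha; simp [AgentState.isAware]
  · rw [Function.update_of_ne ha]
    by_cases hav : a = v
    · subst hav; simp [ha, AgentState.isAware_dropAlert]
    · simp [ha, hav]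

theorem vacancySum_update (g : V → ℝ) (σ : AgentConfig V) (u : V) (s : AgentState) :
    vacancySum g (Function.update σ u s) = vacancySum g σ +
      ((if s.canReceiveAlert = true then g u else 0) -
        if (σ u).canReceiveAlert = true then g u else 0) := by
  rw [← sub_eq_iff_eq_add', vacancySum, vacancySum, ← Finset.sum_sub_distrib,
    Fintype.sum_eq_single u]
  · simp
  · intro v hv
    simp [hv]

theorem vacancySum_passAlert (g : V → ℝ) (σ : AgentConfig V) {u v : V} (huv : u ≠ v)
    (hu : (σ u).hasAlert = true) : vacancySum g (passAlert u v σ) = vacancySum g σ +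
      if (σ v).canReceiveAlert = true then g u - g v else 0 := by
  unfold passAlert
  split_ifs with hv
  · rw [vacancySum_update, vacancySum_update, Function.update_of_ne huv.symm]
    cases e : σ v <;> cases e' : σ u <;>
      simp_all [AgentState.hasAlert, AgentState.dropAlert,
        AgentState.addAlert, AgentState.canReceiveAlert] <;> ring
  · simp

variable {g : Finset V → V → ℝ} {M c B : ℝ}

theorem alertPotential_nonneg (hg : ∀ A v, 0 ≤ g A v) (hM : 0 ≤ M) (hc : 0 ≤ c)
    (σ : AgentConfig V) : 0 ≤ alertPotential g M c σ := by
  unfold alertPotential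
  have := vacancySum_nonneg (hg (awareSet σ)) σ
  split_ifs
  · exact le_rfl
  · positivity

theorem alertPotential_le (hB : 0 ≤ B) (hg : ∀ A v, g A v ≤ B) (hM : 0 ≤ M) (hc : 0 ≤ c)
    (σ : AgentConfig V) :
    alertPotential g M c σ ≤ M * (awareSet σ)ᶜ.card + c * (Fintype.card V * B) := by
  unfold alertPotential
  split_ifs
  · positivity
  · gcongr
    exact vacancySum_le hB (hg _) σ

theorem alertPotential_pos (hg : ∀ A v, 0 ≤ g A v) (hM : 0 < M) (hc : 0 ≤ c)
    {σ : AgentConfig V} (hσ : ¬ AllAware σ) : 0 < alertPotential g M c σ := by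
  rw [← awareSet_eq_univ_iff] at hσ
  rw [alertPotential, if_neg hσ]
  have h1 := mul_nonneg hc (vacancySum_nonneg (hg (awareSet σ)) σ)
  have h2 : 0 < (awareSet σ)ᶜ.card := by
    rw [Finset.card_pos, Finset.nonempty_iff_ne_empty]
    simpa [Finset.compl_eq_empty_iff] using hσ
  have : 0 < M * (awareSet σ)ᶜ.card := mul_pos hM (by exact_mod_cast h2)
  linarith

/-- The aware set grows, so the voltage is replaced by an unrelated one. The old vacancy sum is at
least `0` and the new one at most `n * B`, and the loss of one unaware agent has to pay for that. -/
theorem alertPotential_consumeAlert_le (hg0 : ∀ A v, 0 ≤ g A v) (hB : 0 ≤ B)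
    (hg : ∀ A v, g A v ≤ B) (hM : 0 ≤ M) (hc : 0 ≤ c) {σ : AgentConfig V} {u v : V}
    (hu : σ u = .unaware) (hv : (σ v).hasAlert = true) :
    alertPotential g M c (consumeAlert u v σ) ≤
      alertPotential g M c σ - (M - c * (Fintype.card V * B)) := by
  have huv : v ≠ u := by rintro rfl; simp [hu, AgentState.hasAlert] at hv
  have huA : u ∉ awareSet σ := by simp [mem_awareSet, hu, AgentState.isAware]
  have h1 := alertPotential_le hB hg hM hc (consumeAlert u v σ)
  have hne : awareSet σ ≠ Finset.univ := fun h => huA (h ▸ Finset.mem_univ u)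
  rw [awareSet_consumeAlert huv, Finset.compl_insert,
    Finset.card_erase_of_mem (Finset.mem_compl.2 huA),
    Nat.cast_sub (Finset.card_pos.2 ⟨u, Finset.mem_compl.2 huA⟩)] at h1
  have h2 : alertPotential g M c σ =
      M * (awareSet σ)ᶜ.card + c * vacancySum (g (awareSet σ)) σ := if_neg hne
  have h3 := mul_nonneg hc (vacancySum_nonneg (hg0 (awareSet σ)) σ)
  push_cast at h1
  rw [h2]
  linarith

theorem alertPotential_passAlert {σ : AgentConfig V} (hσ : awareSet σ ≠ Finset.univ) {u v : V}
    (huv : u ≠ v) (hu : (σ u).hasAlert = true) :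
    alertPotential g M c (passAlert u v σ) - alertPotential g M c σ =
      c * if (σ v).canReceiveAlert = true then g (awareSet σ) u - g (awareSet σ) v else 0 := by
  rw [alertPotential, alertPotential, awareSet_passAlert huv, if_neg hσ, if_neg hσ,
    vacancySum_passAlert _ _ huv hu]
  ring

theorem alertPotential_update_awareAW {σ : AgentConfig V} (hσ : awareSet σ ≠ Finset.univ) {u : V}
    (hu : σ u = .awareW) :
    alertPotential g M c (Function.update σ u .awareAW) =
      alertPotential g M c σ - c * g (awareSet σ) u := by
  rw [alertPotential, alertPotential, awareSet_update (by rw [hu]; rfl), if_neg hσ, if_neg hσ,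
    vacancySum_update, hu]
  simp [AgentState.canReceiveAlert]
  ring

variable (G : SimpleGraph V) [DecidableRel G.Adj]
  {Δ : ℕ} {p : ℝ} (sel : AgentConfig V → V → PMF V) {W : Finset V} {σ : AgentConfig V}

open Classical in
theorem expect_activate_alertPotential_le (hp0 : 0 ≤ p) (hp1 : p ≤ 1) (hΔ : 0 < Δ)
    (hsel : IsSelectionRule G sel) (hg0 : ∀ A v, 0 ≤ g A v) (hB : 0 ≤ B)
    (hg : ∀ A v, g A v ≤ B) (hM : 0 ≤ M) (hc : 0 ≤ c) (hres : NoResidual W σ)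
    (hW : ∀ v ∈ W, (σ v).hasWitnessFlag = true) (hσ : awareSet σ ≠ Finset.univ) (x u : V)
    (hx : x ∈ W) (hdeg : G.degree u ≤ Δ) :
    (activate G Δ p sel W u σ).expect (alertPotential g M c) ≤ alertPotential g M c σ +
      ((if σ u = .unaware ∧ ∃ v, IsAlertNeighbor G σ u v
        then -(M - c * (Fintype.card V * B)) else 0) +
      (if u = x then (if (σ x).canReceiveAlert = true then -(p * c * g (awareSet σ) x) else 0)
        else 0) +
      (Δ : ℝ)⁻¹ * c * (if (σ u).hasAlert = true then
        ∑ v, if G.Adj u v then (if (σ v).canReceiveAlert = true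
          then g (awareSet σ) u - g (awareSet σ) v else 0) else 0
        else 0)) := by
  have hflag : u ∈ W ↔ (σ u).hasWitnessFlag = true :=
    ⟨hW u, fun h => by_contra fun hu => by simp [(hres u hu).1] at h⟩
  have hflagx := hW x hx
  cases e : σ u with
  | unaware =>
    have hu : u ∉ W := by simp [hflag, e, AgentState.hasWitnessFlag]
    have hux : u ≠ x := by rintro rfl; exact hu hx
    by_cases hv : ∃ v, IsAlertNeighbor G σ u v
    · rw [activate_of_unaware G sel hu e hv, PMF.expect_bind]
      refine PMF.expect_le_const _ fun v hv' => ?_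
      rw [PMF.expect_pure]
      have := alertPotential_consumeAlert_le hg0 hB hg hM hc e (hsel σ u hv v hv').2
      simp only [hv, hux, AgentState.hasAlert, true_and, if_true, if_false, Bool.false_eq_true,
        mul_zero, add_zero]
      linarith
    · rw [activate_of_unaware_of_not G sel hu e hv, PMF.expect_pure]
      simp [hv, hux, AgentState.hasAlert]
  | aware =>
    have hu : u ∉ W := by simp [hflag, e, AgentState.hasWitnessFlag]
    have hux : u ≠ x := by rintro rfl; exact hu hx
    rw [activate_of_aware G sel hu e, PMF.expect_pure]
    simp [hux, AgentState.hasAlert]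
  | awareC =>
    have hu : u ∉ W := by simp [hflag, e, AgentState.hasWitnessFlag]
    have := (hres u hu).2
    simp [e, AgentState.hasClear] at this
  | awareW =>
    have hu : u ∈ W := by simp [hflag, e, AgentState.hasWitnessFlag]
    rw [expect_activate_of_awareW G sel _ hp0 hp1 hu e, alertPotential_update_awareAW hσ e]
    have h1 := mul_nonneg (mul_nonneg hp0 hc) (hg0 (awareSet σ) u)
    by_cases hux : u = x
    · subst hux
      simp [e, AgentState.hasAlert, AgentState.canReceiveAlert]
      linarith
    -- A token created at a witness other than `x` only removes a nonnegative term.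
    · simp [hux, AgentState.hasAlert]
      linarith
  | awareA | awareAW =>
    have ha : (σ u).hasAlert = true := by simp [e, AgentState.hasAlert]
    have hux : (if u = x then (if (σ x).canReceiveAlert = true
        then -(p * c * g (awareSet σ) x) else 0) else 0) = 0 := by
      split_ifs with h1 h2
      · subst h1; simp [e, AgentState.canReceiveAlert] at h2
      · rfl
      · rfl
    rw [expect_activate_of_hasAlert G sel _ hflag ha hΔ hdeg, hux]
    have h2 : ∀ v, (if G.Adj u v then alertPotential g M c (passAlert u v σ) -
        alertPotential g M c σ else 0) = c * if G.Adj u v then (if (σ v).canReceiveAlert = true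
          then g (awareSet σ) u - g (awareSet σ) v else 0) else 0 := by
      intro v
      split_ifs with h h' <;> [skip; skip; simp]
      all_goals rw [alertPotential_passAlert hσ h.ne ha]; simp [h']
    simp only [h2, ← Finset.mul_sum]
    simp [AgentState.hasAlert, mul_assoc]

/-- With `κ = p * Δ` and `c = n * Δ`, the source term of the voltage at `x` cancels exactly against
the creation of tokens at `x`. What remains is `-n` when `b` is vacant, and otherwise the
consumption of the token at `b` supplies the `-n`, because `M` exceeds the cost of changing the
voltage by `n`. -/
theorem expect_iteration_alertPotential_le [Nonempty V] (hp0 : 0 < p) (hp1 : p ≤ 1) (hΔ : 0 < Δ)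
    (hdeg : ∀ u, G.degree u ≤ Δ) (hsel : IsSelectionRule G sel) (hg0 : ∀ A v, 0 ≤ g A v)
    (hB : 0 ≤ B) (hg : ∀ A v, g A v ≤ B) {x : V}
    (hvolt : ∀ A, x ∈ A → A ≠ Finset.univ → ∃ b ∈ A, (∃ u ∉ A, G.Adj u b) ∧
        ∀ v ∈ A, ∑ v' ∈ A, (if G.Adj v v' then g A v' - g A v else 0) =
          (if v = x then p * Δ * g A x else 0) - (if v = b then 1 else 0))
    (hc : c = Fintype.card V * Δ) (hM : M = c * (Fintype.card V * B) + Fintype.card V)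
    (hres : NoResidual W σ) (hW : ∀ v ∈ W, (σ v).hasWitnessFlag = true) (hσ : ¬ AllAware σ)
    (hx : x ∈ W) :
    (iteration G Δ p sel W σ).expect (alertPotential g M c) + 1 ≤ alertPotential g M c σ := by
  classical
  rw [← awareSet_eq_univ_iff] at hσ
  have hc0 : 0 ≤ c := by rw [hc]; positivity
  have hM0 : 0 ≤ M := by rw [hM]; positivity
  refine expect_iteration_le G sel _ (fun u => expect_activate_alertPotential_le G sel hp0.le hp1
    hΔ hsel hg0 hB hg hM0 hc0 hres hW hσ x u hx (hdeg u)) ?_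
  have hclear : ∀ v, (σ v).hasClear = false := by
    intro v
    by_cases hv : v ∈ W
    · have := hW v hv
      cases e : σ v <;> simp_all [AgentState.hasWitnessFlag, AgentState.hasClear]
    · exact (hres v hv).2
  have hxA : x ∈ awareSet σ := by
    have := hW x hx
    rw [mem_awareSet]
    cases e : σ x <;> simp_all [AgentState.hasWitnessFlag, AgentState.isAware]
  obtain ⟨b, hb, ⟨u, hu, hub⟩, hv⟩ := hvolt _ hxA hσ
  have hΔ' : (0 : ℝ) < Δ := by exact_mod_cast hΔ
  set n : ℝ := (Fintype.card V : ℝ) with hn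
  have hn0 : 0 ≤ n := Nat.cast_nonneg _
  have hMn : M - c * (n * B) = n := by rw [hM]; ring
  have hcn : (Δ : ℝ)⁻¹ * c = n := by rw [hc]; field_simp
  rw [Finset.sum_add_distrib, Finset.sum_add_distrib, ← Finset.mul_sum,
    sum_exclusion_eq G σ hclear, Finset.sum_ite_eq' Finset.univ x, hMn, hcn]
  -- The voltage is harmonic on the aware set away from `x` and `b`, so only vacancies at these two
  -- vertices contribute.
  have h3 : (∑ v, if (σ v).canReceiveAlert = true then
      ∑ u ∈ awareSet σ, (if G.Adj v u then g (awareSet σ) u - g (awareSet σ) v else 0) else 0) =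
      (if (σ x).canReceiveAlert = true then p * Δ * g (awareSet σ) x else 0) -
        if (σ b).canReceiveAlert = true then 1 else 0 := by
    have : ∀ v, (if (σ v).canReceiveAlert = true then
      ∑ u ∈ awareSet σ, (if G.Adj v u then g (awareSet σ) u - g (awareSet σ) v else 0) else 0) =
      (if v = x then (if (σ x).canReceiveAlert = true then p * Δ * g (awareSet σ) x else 0) else 0)
      - (if v = b then (if (σ b).canReceiveAlert = true then 1 else 0) else 0) := by
      intro v
      by_cases h : (σ v).canReceiveAlert = true
      · have hvA : v ∈ awareSet σ := by
          rw [mem_awareSet]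
          cases e : σ v <;> simp_all [AgentState.canReceiveAlert, AgentState.isAware]
        rw [if_pos h, hv v hvA]
        congr 1
        · split_ifs with h1 h2 <;> simp_all
        · split_ifs with h1 h2 <;> simp_all
      · rw [if_neg h]
        split_ifs <;> simp_all
    simp only [this]
    rw [Finset.sum_sub_distrib, Finset.sum_ite_eq', Finset.sum_ite_eq']
    simp
  rw [h3]
  have h4 : p * c * g (awareSet σ) x = n * (p * Δ * g (awareSet σ) x) := by rw [hc]; ring
  have h5 : ∀ a, (if σ a = .unaware ∧ ∃ v, IsAlertNeighbor G σ a v then -n else 0) ≤ 0 := by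
    intro a; split_ifs <;> linarith
  -- If `b` is not vacant it holds a token, and its unaware neighbor `u` alone contributes `-n`.
  have h6 : ∑ a, (if σ a = .unaware ∧ ∃ v, IsAlertNeighbor G σ a v then -n else 0) ≤
      -n + n * if (σ b).canReceiveAlert = true then 1 else 0 := by
    split_ifs with h
    · simpa using Finset.sum_nonpos fun a _ => h5 a
    · have hbA : (σ b).hasAlert = true := by
        have h7 := hclear b
        rw [mem_awareSet] at hb
        cases e : σ b <;> simp_all [AgentState.canReceiveAlert, AgentState.isAware,
          AgentState.hasAlert, AgentState.hasClear]
      have hu' : σ u = .unaware := by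
        rw [mem_awareSet] at hu
        cases e : σ u <;> simp_all [AgentState.isAware]
      have h8 := Finset.sum_le_sum_of_subset_of_nonneg (f := fun a =>
        -(if σ a = .unaware ∧ ∃ v, IsAlertNeighbor G σ a v then -n else 0))
        (Finset.subset_univ {u}) fun a _ _ => neg_nonneg.2 (h5 a)
      rw [Finset.sum_singleton, if_pos ⟨hu', b, hub, hbA⟩, Finset.sum_neg_distrib] at h8
      linarith
  rw [h4]
  have h9 : (if x ∈ Finset.univ then (if (σ x).canReceiveAlert = true then
      -(n * (p * Δ * g (awareSet σ) x)) else 0) else 0) =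
      -(n * if (σ x).canReceiveAlert = true then p * Δ * g (awareSet σ) x else 0) := by
    simp only [Finset.mem_univ, if_true]
    split_ifs <;> simp
  rw [h9]
  linarith

end AlertPotential

/-! ### Gluing the three regimes into one potential -/

section Potential

variable {V : Type*} [Fintype V] [DecidableEq V] (G : SimpleGraph V) [DecidableRel G.Adj]
  {Δ : ℕ} {p : ℝ} (sel : AgentConfig V → V → PMF V) {W : Finset V} {σ : AgentConfig V}

/-- The witnesses without witness flag. -/
def unflagged (W : Finset V) (σ : AgentConfig V) : Finset V :=
  W.filter fun v => (σ v).hasWitnessFlag = false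

theorem unflagged_eq_empty_iff {V : Type*} {W : Finset V} {σ : AgentConfig V} :
    unflagged W σ = ∅ ↔ ∀ v ∈ W, (σ v).hasWitnessFlag = true := by
  simp [unflagged, Finset.filter_eq_empty_iff]

theorem IsMonotoneStep.unflagged_subset {V : Type*} {W : Finset V} {σ σ' : AgentConfig V}
    (h : IsMonotoneStep W σ σ') :
    unflagged W σ' ⊆ unflagged W σ := by
  intro v hv
  simp only [unflagged, Finset.mem_filter] at hv ⊢
  refine ⟨hv.1, ?_⟩
  by_contra hf
  have := h.flag v (by simpa using hf)
  simp [hv.2] at this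

open Classical in
/-- The potential of the whole process: the total weight while there are residual agents, then the
number of unflagged witnesses, then the alert potential. -/
noncomputable def potential (W : Finset V) (F : AgentConfig V → ℝ) (a₁ B₁ a₂ B₂ : ℝ)
    (σ : AgentConfig V) : ℝ :=
  if NoResidual W σ then
    if unflagged W σ = ∅ then F σ else a₂ * (unflagged W σ).card + B₂
  else a₁ * (totalWeight σ + 1) + B₁

variable {F : AgentConfig V → ℝ} {a₁ B₁ a₂ B₂ : ℝ}

theorem potential_nonneg (hF : ∀ σ, 0 ≤ F σ) (ha₁ : 0 ≤ a₁) (hB₁ : 0 ≤ B₁) (ha₂ : 0 ≤ a₂)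
    (hB₂ : 0 ≤ B₂) (σ : AgentConfig V) : 0 ≤ potential W F a₁ B₁ a₂ B₂ σ := by
  have := totalWeight_nonneg σ
  unfold potential
  split_ifs <;> [exact hF σ; positivity; positivity]

theorem potential_le_of_noResidual (hF : ∀ σ, F σ ≤ B₂) (ha₂ : 0 ≤ a₂) (h : NoResidual W σ) :
    potential W F a₁ B₁ a₂ B₂ σ ≤ a₂ * (unflagged W σ).card + B₂ := by
  rw [potential, if_pos h]
  split_ifs
  · exact (hF σ).trans (le_add_of_nonneg_left (by positivity))
  · exact le_rfl

/-- `B₁` dominates both later regimes, so the first formula bounds the potential everywhere and its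
drift may be computed without knowing whether residual agents survive the step. -/
theorem potential_le (hF : ∀ σ, F σ ≤ B₂) (ha₁ : 0 ≤ a₁) (ha₂ : 0 ≤ a₂)
    (hB₁ : a₂ * W.card + B₂ ≤ B₁) (σ : AgentConfig V) :
    potential W F a₁ B₁ a₂ B₂ σ ≤ a₁ * (totalWeight σ + 1) + B₁ := by
  by_cases h : NoResidual W σ
  · refine (potential_le_of_noResidual hF ha₂ h).trans ?_
    have h1 : ((unflagged W σ).card : ℝ) ≤ W.card := by
      exact_mod_cast Finset.card_le_card (Finset.filter_subset _ _)
    have h2 := mul_le_mul_of_nonneg_left h1 ha₂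
    have h3 := totalWeight_nonneg σ
    have : 0 ≤ a₁ * (totalWeight σ + 1) := by positivity
    linarith
  · rw [potential, if_neg h]

/-- At least one residual agent gives `-1` and the witnesses give at most `p * W.card`, summed over
activations; `a₁` rescales this negative total to `-n`. -/
theorem expect_iteration_potential_le_of_residual [Nonempty V] (hp0 : 0 < p) (hp1 : p ≤ 1)
    (hΔ : 0 < Δ) (hdeg : ∀ u, G.degree u ≤ Δ) (hsel : IsSelectionRule G sel)
    (hpW : p * W.card < 1) (hF : ∀ σ, F σ ≤ B₂) (ha₁ : a₁ = Fintype.card V / (1 - p * W.card))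
    (ha₂ : 0 ≤ a₂) (hB₁ : a₂ * W.card + B₂ ≤ B₁) (h : ¬ NoResidual W σ) :
    (iteration G Δ p sel W σ).expect (potential W F a₁ B₁ a₂ B₂) + 1 ≤
      potential W F a₁ B₁ a₂ B₂ σ := by
  have hd : 0 < 1 - p * W.card := by linarith
  have ha₁0 : 0 ≤ a₁ := by rw [ha₁]; positivity
  refine expect_iteration_le G sel _ (d := fun u => a₁ * ((if u ∈ W then p else 0) -
    if u ∉ W ∧ ((σ u).hasWitnessFlag = true ∨ (σ u).hasClear = true) then 1 else 0))
    (fun u => ?_) ?_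
  · refine (PMF.expect_mono _ fun σ' _ => potential_le hF ha₁0 ha₂ hB₁ σ').trans ?_
    have e : ∀ σ' : AgentConfig V, a₁ * (totalWeight σ' + 1) + B₁ =
        a₁ * totalWeight σ' + (a₁ + B₁) := fun σ' => by ring
    simp only [e]
    rw [PMF.expect_add_const, potential, if_neg h]
    have := mul_le_mul_of_nonneg_left (expect_activate_totalWeight_le G sel (W := W) (u := u) σ
      hp0.le hp1 hΔ (hdeg u) hsel) ha₁0
    linarith
  · rw [← Finset.mul_sum, Finset.sum_sub_distrib]
    have h1 : ∑ u, (if u ∈ W then p else 0) = p * W.card := by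
      simp [mul_comm]
    have h2 : (1 : ℝ) ≤ ∑ u, if u ∉ W ∧ ((σ u).hasWitnessFlag = true ∨ (σ u).hasClear = true)
        then 1 else 0 := by
      simp only [NoResidual, not_forall] at h
      obtain ⟨v, hv, hv'⟩ := h
      have hv2 : (σ v).hasWitnessFlag = true ∨ (σ v).hasClear = true := by
        by_contra hc
        simp only [not_or, Bool.not_eq_true] at hc
        exact hv' hc
      refine le_trans (by rw [if_pos ⟨hv, hv2⟩]) (Finset.single_le_sum (f := fun u =>
        if u ∉ W ∧ ((σ u).hasWitnessFlag = true ∨ (σ u).hasClear = true) then (1 : ℝ) else 0)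
        (fun u _ => ?_) (Finset.mem_univ v))
      split_ifs <;> norm_num
    rw [h1]
    have h3 : a₁ * (1 - p * W.card) = Fintype.card V := by
      rw [ha₁]; field_simp
    have := mul_le_mul_of_nonneg_left h2 ha₁0
    linarith

/-- A single unflagged witness `x` suffices: its activation lowers the count with probability `p`,
contributing `-p * a₂ = -n`, and no other activation raises the potential. -/
theorem expect_iteration_potential_le_of_unflagged [Nonempty V] (hp0 : 0 < p) (hp1 : p ≤ 1)
    (hsel : IsSelectionRule G sel) (hF : ∀ σ, F σ ≤ B₂) (ha₂ : a₂ = Fintype.card V / p)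
    (h : NoResidual W σ) (hW : unflagged W σ ≠ ∅) :
    (iteration G Δ p sel W σ).expect (potential W F a₁ B₁ a₂ B₂) + 1 ≤
      potential W F a₁ B₁ a₂ B₂ σ := by
  have ha₂0 : 0 ≤ a₂ := by rw [ha₂]; positivity
  obtain ⟨x, hx⟩ := Finset.nonempty_iff_ne_empty.2 hW
  have hx' := hx
  rw [unflagged, Finset.mem_filter] at hx'
  have hσ : potential W F a₁ B₁ a₂ B₂ σ = a₂ * (unflagged W σ).card + B₂ := by
    rw [potential, if_pos h, if_neg hW]
  have hle : ∀ σ', IsMonotoneStep W σ σ' →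
      potential W F a₁ B₁ a₂ B₂ σ' ≤ potential W F a₁ B₁ a₂ B₂ σ := by
    intro σ' h'
    rw [hσ]
    refine (potential_le_of_noResidual hF ha₂0 h'.noResidual).trans ?_
    have h1 : ((unflagged W σ').card : ℝ) ≤ (unflagged W σ).card := by
      exact_mod_cast Finset.card_le_card h'.unflagged_subset
    gcongr
  refine expect_iteration_le G sel _ (d := fun u => if u = x then -(Fintype.card V : ℝ) else 0)
    (fun u => ?_) (by simp)
  split_ifs with hux
  · subst hux
    rw [expect_activate_of_mem_of_not_flag G sel _ hp0.le hp1 hx'.1 hx'.2]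
    have hstep := isMonotoneStep_update h hx'.1 (s := .awareW) rfl
    have h1 := potential_le_of_noResidual (a₁ := a₁) (B₁ := B₁) hF ha₂0 hstep.noResidual
    have h2 : (unflagged W (Function.update σ u .awareW)).card + 1 ≤ (unflagged W σ).card := by
      refine Finset.card_lt_card ⟨hstep.unflagged_subset, fun hs => ?_⟩
      have := hs hx
      rw [unflagged, Finset.mem_filter, Function.update_self] at this
      exact absurd this.2 (by decide)
    have h3 : ((unflagged W (Function.update σ u .awareW)).card : ℝ) + 1 ≤
        (unflagged W σ).card := by exact_mod_cast h2
    have h4 := mul_le_mul_of_nonneg_left h3 ha₂0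
    have h5 : potential W F a₁ B₁ a₂ B₂ (Function.update σ u .awareW) ≤
        potential W F a₁ B₁ a₂ B₂ σ - a₂ := by linarith
    have h6 := mul_le_mul_of_nonneg_left h5 hp0.le
    have h7 : p * a₂ = Fintype.card V := by rw [ha₂]; field_simp
    linarith
  · rw [add_zero]
    exact PMF.expect_le_const _ fun σ' hσ' =>
      hle σ' (isMonotoneStep_of_mem_support_activate G sel hsel h hσ')

theorem isMonotoneStep_of_mem_support_iteration [Nonempty V] (hsel : IsSelectionRule G sel)
    (h : NoResidual W σ) {σ' : AgentConfig V}
    (hσ' : σ' ∈ (iteration G Δ p sel W σ).support) : IsMonotoneStep W σ σ' := by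
  rw [iteration, PMF.mem_support_bind_iff] at hσ'
  obtain ⟨u, -, hu⟩ := hσ'
  exact isMonotoneStep_of_mem_support_activate G sel hsel h hu

theorem expect_iteration_potential_of_flagged [Nonempty V] (hsel : IsSelectionRule G sel)
    (h : NoResidual W σ) (hW : unflagged W σ = ∅) :
    (iteration G Δ p sel W σ).expect (potential W F a₁ B₁ a₂ B₂) =
      (iteration G Δ p sel W σ).expect F := by
  refine le_antisymm ?_ ?_ <;> refine PMF.expect_mono _ fun σ' hσ' => le_of_eq ?_
  all_goals
    have h' := isMonotoneStep_of_mem_support_iteration G sel hsel h hσ'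
    rw [potential, if_pos h'.noResidual,
      if_pos (Finset.subset_empty.1 (hW ▸ h'.unflagged_subset))]

/-- The constant of the bound on the expected number of iterations. -/
noncomputable def awareConstant (Δ w : ℕ) (p : ℝ) : ℝ :=
  3 / (1 - p * w) + 1 / p + (2 * (Δ * (1 + 2 / (p * Δ))) + 1)

theorem exists_potential [Nonempty V] (hG : G.Connected) {w : ℕ} (hp0 : 0 < p) (hp1 : p ≤ 1)
    (hΔ : 0 < Δ) (hdeg : ∀ u, G.degree u ≤ Δ) (hsel : IsSelectionRule G sel) (hpw : p * w < 1)
    (hW : W.Nonempty) (hWw : W.card ≤ w) : ∃ H : AgentConfig V → ℝ, (∀ σ, 0 ≤ H σ) ∧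
      (∀ σ, H σ ≤ awareConstant Δ w p * (Fintype.card V : ℝ) ^ 5) ∧
      (∀ σ, (iteration G Δ p sel W σ).expect H + (if H σ = 0 then 0 else 1) ≤ H σ) ∧
      ∀ σ, H σ = 0 → AllAware σ := by
  obtain ⟨x, hx⟩ := hW
  have hΔ' : (0 : ℝ) < Δ := by exact_mod_cast hΔ
  have hκ : 0 < p * Δ := by positivity
  obtain ⟨g, hg0, hg, hvolt⟩ := hG.exists_voltage_of_mem hκ x
  set n : ℝ := (Fintype.card V : ℝ) with hn
  have hn1 : 1 ≤ n := by
    have : 1 ≤ Fintype.card V := Fintype.card_pos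
    rw [hn]; exact_mod_cast this
  have hn0 : 0 < n := by linarith
  set k : ℝ := 1 + 2 / (p * Δ) with hk
  have hk0 : 0 < k := by positivity
  set c : ℝ := n * Δ with hc
  have hc0 : 0 < c := by positivity
  set M : ℝ := c * (n * (k * n ^ 2)) + n with hM
  have hM0 : 0 < M := by positivity
  set F := alertPotential g M c (V := V) with hFdef
  have hB : 0 ≤ k * n ^ 2 := by positivity
  set B₂ : ℝ := (2 * (Δ * k) + 1) * n ^ 5 with hB₂
  have hF0 : ∀ σ, 0 ≤ F σ := alertPotential_nonneg hg0 hM0.le hc0.le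
  have hF : ∀ σ, F σ ≤ B₂ := by
    intro σ
    refine (alertPotential_le hB hg hM0.le hc0.le σ).trans ?_
    have h1 : (((awareSet σ)ᶜ.card : ℕ) : ℝ) ≤ n := by
      rw [hn]; exact_mod_cast Finset.card_le_univ _
    have h2 := mul_le_mul_of_nonneg_left h1 hM0.le
    -- The exponent `5` arises here: up to `n` unaware agents, each weighted by `M`, whose leading
    -- term is `Δ * k * n ^ 4`.
    have h3 : M * n + c * (n * (k * n ^ 2)) = Δ * k * n ^ 5 + n ^ 2 + Δ * k * n ^ 4 := by
      rw [hM, hc]; ring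
    have h4 : n ^ 2 ≤ n ^ 5 := pow_le_pow_right₀ hn1 (by norm_num)
    have h5 : Δ * k * n ^ 4 ≤ Δ * k * n ^ 5 :=
      mul_le_mul_of_nonneg_left (pow_le_pow_right₀ hn1 (by norm_num)) (by positivity)
    rw [hB₂]
    linarith
  have hB₂0 : 0 ≤ B₂ := by positivity
  set a₂ : ℝ := n / p with ha₂
  have ha₂0 : 0 < a₂ := by positivity
  set B₁ : ℝ := a₂ * W.card + B₂ with hB₁
  have hB₁0 : 0 ≤ B₁ := by positivity
  have hWw' : (W.card : ℝ) ≤ w := by exact_mod_cast hWw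
  have hpW' := mul_le_mul_of_nonneg_left hWw' hp0.le
  have hpW : p * W.card < 1 := by linarith
  have hd : 0 < 1 - p * W.card := by linarith
  have hdw : 0 < 1 - p * w := by linarith
  set a₁ : ℝ := n / (1 - p * W.card) with ha₁
  have ha₁0 : 0 < a₁ := by positivity
  have hgood : ∀ σ, potential W F a₁ B₁ a₂ B₂ σ = 0 →
      NoResidual W σ ∧ unflagged W σ = ∅ ∧ AllAware σ := by
    intro σ hσ
    rw [potential] at hσ
    have htw := totalWeight_nonneg σ
    split_ifs at hσ with h1 h2
    · exact ⟨h1, h2, by_contra fun h3 => (alertPotential_pos hg0 hM0 hc0.le h3).ne' hσ⟩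
    -- Both earlier regimes have strictly positive potential, so a zero can only occur in the last
    -- one.
    · have : 0 < (unflagged W σ).card := Finset.card_pos.2 (Finset.nonempty_iff_ne_empty.2 h2)
      have : 0 < a₂ * (unflagged W σ).card + B₂ := by positivity
      exact absurd hσ this.ne'
    · have : 0 < a₁ * (totalWeight σ + 1) + B₁ := by positivity
      exact absurd hσ this.ne'
  refine ⟨potential W F a₁ B₁ a₂ B₂, potential_nonneg hF0 ha₁0.le hB₁0 ha₂0.le hB₂0,
    fun σ => ?_, fun σ => ?_, fun σ hσ => (hgood σ hσ).2.2⟩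
  · refine (potential_le hF ha₁0.le ha₂0.le le_rfl σ).trans ?_
    have h1 := totalWeight_le σ
    -- The weight is at most `2 * n`, so `totalWeight σ + 1 ≤ 3 * n`; replacing `W.card` by `w`
    -- makes the constant independent of `W`.
    have h2 : a₁ * (totalWeight σ + 1) ≤ n / (1 - p * w) * (3 * n) := by
      have h3 := totalWeight_nonneg σ
      refine mul_le_mul ?_ (by rw [← hn] at h1; linarith) (by linarith) (by positivity)
      exact div_le_div_of_nonneg_left hn0.le hdw (by linarith)
    have h4 : n / (1 - p * w) * (3 * n) = 3 / (1 - p * w) * n ^ 2 := by ring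
    have h5 : 3 / (1 - p * w) * n ^ 2 ≤ 3 / (1 - p * w) * n ^ 5 :=
      mul_le_mul_of_nonneg_left (pow_le_pow_right₀ hn1 (by norm_num)) (by positivity)
    have h6 : (W.card : ℝ) ≤ n := by rw [hn]; exact_mod_cast Finset.card_le_univ _
    have h7 := mul_le_mul_of_nonneg_left h6 ha₂0.le
    have h8 : a₂ * n = 1 / p * n ^ 2 := by rw [ha₂]; ring
    have h9 : 1 / p * n ^ 2 ≤ 1 / p * n ^ 5 :=
      mul_le_mul_of_nonneg_left (pow_le_pow_right₀ hn1 (by norm_num)) (by positivity)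
    rw [awareConstant, ← hk, add_mul, add_mul, ← hB₂]
    linarith
  · by_cases h1 : NoResidual W σ
    · by_cases h2 : unflagged W σ = ∅
      · by_cases h3 : AllAware σ
        · have h4 : ∀ σ', AllAware σ' → F σ' = 0 := fun σ' h =>
            if_pos (awareSet_eq_univ_iff.2 h)
          have h5 : potential W F a₁ B₁ a₂ B₂ σ = 0 := by
            rw [potential, if_pos h1, if_pos h2, h4 σ h3]
          rw [expect_iteration_potential_of_flagged G sel hsel h1 h2, if_pos h5, h5, add_zero]
          exact (PMF.expect_eq_zero _ fun σ' hσ' => h4 σ' fun v =>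
            (isMonotoneStep_of_mem_support_iteration G sel hsel h1 hσ').aware v (h3 v)).le
        · rw [if_neg fun h => h3 (hgood σ h).2.2,
            expect_iteration_potential_of_flagged G sel hsel h1 h2, potential, if_pos h1,
            if_pos h2]
          exact expect_iteration_alertPotential_le G sel hp0 hp1 hΔ hdeg hsel hg0 hB hg hvolt hc
            hM h1 (unflagged_eq_empty_iff.1 h2) h3 hx
      · rw [if_neg fun h => h2 (hgood σ h).2.1]
        exact expect_iteration_potential_le_of_unflagged G sel hp0 hp1 hsel hF ha₂ h1 h2
    · rw [if_neg fun h => h1 (hgood σ h).1]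
      exact expect_iteration_potential_le_of_residual G sel hp0 hp1 hΔ hdeg hsel hpW hF ha₁
        ha₂0.le le_rfl h1

end Potential

/-! ### From drift to expected time along an execution -/

theorem setLIntegral_comp_eq_sum {Ω β : Type*} [MeasurableSpace Ω] [Fintype β] (P : Measure Ω)
    {Y : Ω → β} (hY : ∀ b, MeasurableSet {ω | Y ω = b}) (A : Set Ω) (f : β → ℝ≥0∞) :
    ∫⁻ ω in A, f (Y ω) ∂P = ∑ b, f b * P (A ∩ {ω | Y ω = b}) := by
  classical
  have h : ∀ ω, f (Y ω) = ∑ b, {ω | Y ω = b}.indicator (fun _ => f b) ω := by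
    intro ω
    simp [Set.indicator_apply]
  simp only [h]
  rw [lintegral_finsetSum _ fun b _ => measurable_const.indicator (hY b)]
  refine Finset.sum_congr rfl fun b _ => ?_
  rw [lintegral_indicator_const (hY b), Measure.restrict_apply (hY b), Set.inter_comm]

theorem lintegral_comp_eq_sum {Ω β : Type*} [MeasurableSpace Ω] [Fintype β] (P : Measure Ω)
    {Y : Ω → β} (hY : ∀ b, MeasurableSet {ω | Y ω = b}) (f : β → ℝ≥0∞) :
    ∫⁻ ω, f (Y ω) ∂P = ∑ b, f b * P {ω | Y ω = b} := by
  simpa using setLIntegral_comp_eq_sum P hY Set.univ f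

section Execution

variable {V : Type*} [Fintype V] [DecidableEq V] [Nonempty V] {G : SimpleGraph V}
  [DecidableRel G.Adj] {Δ w : ℕ} {p : ℝ} {sel : AgentConfig V → V → PMF V} {σ₀ : AgentConfig V}
  {Ω : Type*} [mΩ : MeasurableSpace Ω] {P : Measure Ω} {ℱ : Filtration ℕ mΩ}
  {𝒲 : ℕ → Ω → Finset V} {X : ℕ → Ω → AgentConfig V}

/-- On an event of the past that fixes the next witness set, the adaptive process moves by the
Markov kernel of that set. -/
theorem IsExecution.measure_step (hX : IsExecution G Δ w p sel σ₀ P ℱ 𝒲 X) {t : ℕ}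
    {S : Finset V} {A : Set Ω} (hA : MeasurableSet[ℱ t] A) (hAS : ∀ ω ∈ A, 𝒲 (t + 1) ω = S)
    (σ : AgentConfig V) : P (A ∩ {ω | X (t + 1) ω = σ}) =
      ∑ τ, iteration G Δ p sel S τ σ * P (A ∩ {ω | X t ω = τ}) := by
  rw [hX.step t σ A hA, ← setLIntegral_comp_eq_sum P (fun τ => ℱ.le t _ (hX.adapted t τ)) A
    (fun τ => iteration G Δ p sel S τ σ)]
  exact setLIntegral_congr_fun (ℱ.le t _ hA) fun ω hω => by simp only [hAS ω hω]

variable {T : ℕ} {H : Finset V → AgentConfig V → ℝ}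

/-- The final witness set is random, and `H` is indexed by it. It is read off as `𝒲 (T + 1)`, which
`predictable` makes known at time `T`; this also covers `T = 0`, as `predictable` says nothing about
`𝒲 0`. -/
theorem IsExecution.measurableSet_witness (hX : IsExecution G Δ w p sel σ₀ P ℱ 𝒲 X) {t : ℕ}
    (hTt : T ≤ t) (S : Finset V) : MeasurableSet[ℱ t] {ω | 𝒲 (T + 1) ω = S} :=
  ℱ.mono hTt _ (hX.predictable T S)

theorem IsExecution.measurableSet_pair (hX : IsExecution G Δ w p sel σ₀ P ℱ 𝒲 X) {t : ℕ}
    (hTt : T ≤ t) (b : Finset V × AgentConfig V) :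
    MeasurableSet[ℱ t] {ω | (𝒲 (T + 1) ω, X t ω) = b} := by
  have : {ω | (𝒲 (T + 1) ω, X t ω) = b} = {ω | 𝒲 (T + 1) ω = b.1} ∩ {ω | X t ω = b.2} := by
    ext ω; simp [Prod.ext_iff]
  rw [this]
  exact (hX.measurableSet_witness hTt b.1).inter (hX.adapted t b.2)

/-- Splitting according to the finitely many values of the final witness set and of the
configuration turns the pointwise drift of `H` into one for the integrals. -/
theorem IsExecution.lintegral_potential_succ_add_le (hX : IsExecution G Δ w p sel σ₀ P ℱ 𝒲 X)
    (hconst : ∀ t ω, T ≤ t → 𝒲 t ω = 𝒲 T ω) (hH0 : ∀ S σ, 0 ≤ H S σ)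
    (hH : ∀ S σ, (iteration G Δ p sel S σ).expect (H S) + (if H S σ = 0 then 0 else 1) ≤ H S σ)
    {t : ℕ} (hTt : T ≤ t) :
    ∫⁻ ω, ENNReal.ofReal (H (𝒲 (T + 1) ω) (X (t + 1) ω)) ∂P +
      ∫⁻ ω, (if H (𝒲 (T + 1) ω) (X t ω) = 0 then 0 else 1) ∂P ≤
      ∫⁻ ω, ENNReal.ofReal (H (𝒲 (T + 1) ω) (X t ω)) ∂P := by
  rw [lintegral_comp_eq_sum P (Y := fun ω => (𝒲 (T + 1) ω, X (t + 1) ω))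
      (fun b => ℱ.le _ _ (hX.measurableSet_pair (by omega) b))
      (fun b => ENNReal.ofReal (H b.1 b.2)),
    lintegral_comp_eq_sum P (Y := fun ω => (𝒲 (T + 1) ω, X t ω))
      (fun b => ℱ.le _ _ (hX.measurableSet_pair hTt b))
      (fun b => ENNReal.ofReal (H b.1 b.2)),
    lintegral_comp_eq_sum P (Y := fun ω => (𝒲 (T + 1) ω, X t ω))
      (fun b => ℱ.le _ _ (hX.measurableSet_pair hTt b))
      (fun b => if H b.1 b.2 = 0 then 0 else 1),
    Fintype.sum_prod_type, Fintype.sum_prod_type, Fintype.sum_prod_type,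
    ← Finset.sum_add_distrib]
  refine Finset.sum_le_sum fun S _ => ?_
  set A := {ω | 𝒲 (T + 1) ω = S} with hA
  have hpair : ∀ s σ, {ω | (𝒲 (T + 1) ω, X s ω) = (S, σ)} = A ∩ {ω | X s ω = σ} := by
    intro s σ; ext ω; simp [hA]
  simp only [hpair]
  have hAS : ∀ ω ∈ A, 𝒲 (t + 1) ω = S := by
    intro ω hω
    rw [hconst (t + 1) ω (by omega), ← hconst (T + 1) ω (by omega)]
    exact hω
  have hstep : ∀ σ, P (A ∩ {ω | X (t + 1) ω = σ}) =
      ∑ τ, iteration G Δ p sel S τ σ * P (A ∩ {ω | X t ω = τ}) :=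
    hX.measure_step (hX.measurableSet_witness hTt S) hAS
  simp only [hstep, Finset.mul_sum]
  rw [Finset.sum_comm, ← Finset.sum_add_distrib]
  refine Finset.sum_le_sum fun τ _ => ?_
  have h1 : ∀ σ, ENNReal.ofReal (H S σ) * (iteration G Δ p sel S τ σ * P (A ∩ {ω | X t ω = τ})) =
      iteration G Δ p sel S τ σ * ENNReal.ofReal (H S σ) * P (A ∩ {ω | X t ω = τ}) :=
    fun σ => by ring
  simp only [h1]
  rw [← Finset.sum_mul, PMF.sum_mul_ofReal_eq _ (hH0 S), ← add_mul]
  gcongr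
  have h2 := ENNReal.ofReal_le_ofReal (hH S τ)
  rw [ENNReal.ofReal_add (PMF.expect_nonneg _ (hH0 S)) (by split_ifs <;> norm_num)] at h2
  refine le_trans (add_le_add le_rfl ?_) h2
  split_ifs <;> simp

/-- At a zero of `H` the drift inequality says that a nonnegative function has expectation at most
zero, so every transition to a nonzero value has probability zero; there are countably many such
null events. -/
theorem IsExecution.ae_absorbing (hX : IsExecution G Δ w p sel σ₀ P ℱ 𝒲 X)
    (hconst : ∀ t ω, T ≤ t → 𝒲 t ω = 𝒲 T ω) (hH0 : ∀ S σ, 0 ≤ H S σ)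
    (hH : ∀ S σ, (iteration G Δ p sel S σ).expect (H S) + (if H S σ = 0 then 0 else 1) ≤ H S σ) :
    ∀ᵐ ω ∂P, ∀ t, T ≤ t → H (𝒲 (T + 1) ω) (X t ω) = 0 →
      H (𝒲 (T + 1) ω) (X (t + 1) ω) = 0 := by
  have key : ∀ t S τ σ, T ≤ t → H S τ = 0 → H S σ ≠ 0 →
      ∀ᵐ ω ∂P, ¬ (((𝒲 (T + 1) ω, X t ω) = (S, τ)) ∧ X (t + 1) ω = σ) := by
    intro t S τ σ hTt hτ hσ
    rw [ae_iff]
    simp only [not_not]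
    have hAS : ∀ ω ∈ {ω | (𝒲 (T + 1) ω, X t ω) = (S, τ)}, 𝒲 (t + 1) ω = S := by
      intro ω hω
      rw [hconst (t + 1) ω (by omega), ← hconst (T + 1) ω (by omega)]
      exact (Prod.ext_iff.1 hω).1
    refine (hX.measure_step (hX.measurableSet_pair hTt (S, τ)) hAS σ).trans ?_
    refine Finset.sum_eq_zero fun τ' _ => ?_
    by_cases h : τ' = τ
    · subst h
      have h1 := hH S τ'
      rw [if_pos hτ, hτ, add_zero] at h1
      have h2 : ∀ a ∈ Finset.univ, 0 ≤ (iteration G Δ p sel S τ' a).toReal * H S a := fun a _ =>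
        mul_nonneg ENNReal.toReal_nonneg (hH0 S a)
      have h3 := (Finset.sum_eq_zero_iff_of_nonneg h2).1
        (le_antisymm h1 (Finset.sum_nonneg h2)) σ (Finset.mem_univ σ)
      have h4 := (mul_eq_zero.1 h3).resolve_right hσ
      rw [ENNReal.toReal_eq_zero_iff] at h4
      rw [h4.resolve_right (PMF.apply_ne_top _ _), zero_mul]
    · have : {ω | (𝒲 (T + 1) ω, X t ω) = (S, τ)} ∩ {ω | X t ω = τ'} = ∅ := by
        ext ω
        simp only [Set.mem_inter_iff, Set.mem_ofPred_eq, Prod.ext_iff, Set.mem_empty_iff_false,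
          iff_false, not_and]
        exact fun h1 h2 => h (h2.symm.trans h1.2)
      rw [this, measure_empty, mul_zero]
  rw [ae_all_iff]
  intro t
  by_cases hTt : T ≤ t
  · have h1 : ∀ᵐ ω ∂P, ∀ S τ σ, H S τ = 0 → H S σ ≠ 0 →
        ¬ (((𝒲 (T + 1) ω, X t ω) = (S, τ)) ∧ X (t + 1) ω = σ) := by
      simp only [ae_all_iff]
      exact fun S τ σ h1 h2 => key t S τ σ hTt h1 h2
    filter_upwards [h1] with ω hω _ h
    by_contra h'
    exact hω _ _ _ h h' ⟨rfl, rfl⟩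
  · exact Filter.Eventually.of_forall fun ω h => absurd h hTt

/-- By absorption the times with `f ≠ 0` form an initial segment, whose length bounds the time to
settle; if `f` never vanishes, the sum is infinite. -/
theorem awareTime_le_tsum {V : Type*} {x : ℕ → AgentConfig V} {f : AgentConfig V → ℝ}
    (hf : ∀ σ, f σ = 0 → AllAware σ) (habs : ∀ t, T ≤ t → f (x t) = 0 → f (x (t + 1)) = 0) :
    awareTime x T ≤ ∑' k, if f (x (T + k)) = 0 then 0 else 1 := by
  classical
  by_cases h : ∃ k, f (x (T + k)) = 0
  · have h1 : ∀ t, T + Nat.find h ≤ t → f (x t) = 0 := by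
      intro t ht
      induction t, ht using Nat.le_induction with
      | base => exact Nat.find_spec h
      | succ t ht ih => exact habs t (by omega) ih
    refine (iInf₂_le (Nat.find h) fun t ht => hf _ (h1 t ht)).trans ?_
    refine le_trans (le_of_eq ?_) (ENNReal.sum_le_tsum (Finset.range (Nat.find h)))
    rw [Finset.sum_congr rfl fun k hk => if_neg (Nat.find_min h (Finset.mem_range.1 hk))]
    simp
  · push Not at h
    simp only [h, if_false]
    rw [ENNReal.tsum_const_eq_top_of_ne_zero one_ne_zero]
    exact le_top

theorem IsExecution.lintegral_awareTime_le [IsProbabilityMeasure P]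
    (hX : IsExecution G Δ w p sel σ₀ P ℱ 𝒲 X)
    (hconst : ∀ t ω, T ≤ t → 𝒲 t ω = 𝒲 T ω) (hH0 : ∀ S σ, 0 ≤ H S σ)
    (hH : ∀ S σ, (iteration G Δ p sel S σ).expect (H S) + (if H S σ = 0 then 0 else 1) ≤ H S σ)
    (haware : ∀ ω σ, H (𝒲 T ω) σ = 0 → AllAware σ) {B : ℝ} (hB : ∀ S σ, H S σ ≤ B) :
    ∫⁻ ω, awareTime (fun t => X t ω) T ∂P ≤ ENNReal.ofReal B := by
  have hW : ∀ ω, 𝒲 (T + 1) ω = 𝒲 T ω := fun ω => hconst (T + 1) ω (by omega)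
  have hmeas : ∀ k, Measurable fun ω =>
      (if H (𝒲 (T + 1) ω) (X (T + k) ω) = 0 then 0 else 1 : ℝ≥0∞) := by
    intro k
    let _ : MeasurableSpace (Finset V × AgentConfig V) := ⊤
    have h1 : Measurable fun ω => (𝒲 (T + 1) ω, X (T + k) ω) :=
      measurable_to_countable' fun b => ℱ.le _ _ (hX.measurableSet_pair (by omega) b)
    exact (measurable_from_top (f := fun b : Finset V × AgentConfig V =>
      (if H b.1 b.2 = 0 then 0 else 1 : ℝ≥0∞))).comp h1
  calc ∫⁻ ω, awareTime (fun t => X t ω) T ∂P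
      ≤ ∫⁻ ω, ∑' k, (if H (𝒲 (T + 1) ω) (X (T + k) ω) = 0 then 0 else 1) ∂P := by
        refine lintegral_mono_ae ?_
        filter_upwards [hX.ae_absorbing hconst hH0 hH] with ω hω
        exact awareTime_le_tsum (x := fun t => X t ω) (f := H (𝒲 (T + 1) ω))
          (fun σ h => haware ω σ (hW ω ▸ h)) hω
    _ = ∑' k, ∫⁻ ω, (if H (𝒲 (T + 1) ω) (X (T + k) ω) = 0 then 0 else 1) ∂P :=
        lintegral_tsum fun k => (hmeas k).aemeasurable
    _ ≤ ENNReal.ofReal B := by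
        refine ENNReal.tsum_le_of_sum_range_le fun k => ?_
        -- The drift inequalities telescope: expected time spent so far plus remaining potential is
        -- at most the initial potential.
        have h1 : ∀ k, ∑ i ∈ Finset.range k,
            ∫⁻ ω, (if H (𝒲 (T + 1) ω) (X (T + i) ω) = 0 then 0 else 1) ∂P +
            ∫⁻ ω, ENNReal.ofReal (H (𝒲 (T + 1) ω) (X (T + k) ω)) ∂P ≤
            ∫⁻ ω, ENNReal.ofReal (H (𝒲 (T + 1) ω) (X T ω)) ∂P := by
          intro k
          induction k with
          | zero => simp
          | succ k ih =>
            refine le_trans ?_ ih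
            rw [Finset.sum_range_succ, add_assoc]
            gcongr
            rw [add_comm]
            exact hX.lintegral_potential_succ_add_le hconst hH0 hH (t := T + k) (by omega)
        refine le_self_add.trans ((h1 k).trans ?_)
        refine (lintegral_mono fun ω => ENNReal.ofReal_le_ofReal (hB _ _)).trans ?_
        simp

end Execution

theorem mainTheorem3 (Δ w : ℕ) (hΔ : 1 ≤ Δ) (hw : 1 ≤ w) (p : ℝ) (hp0 : 0 < p)
    (hpw : p < 1 / (w : ℝ)) :
    ∃ C : ℝ, ∀ (V : Type*) [Fintype V] [DecidableEq V] [Nonempty V]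
      (G : SimpleGraph V) [DecidableRel G.Adj], G.Connected → G.maxDegree ≤ Δ →
      ∀ sel : AgentConfig V → V → PMF V, IsSelectionRule G sel →
      ∀ σ₀ : AgentConfig V, StateInvariant G σ₀ →
      ∀ (Ω : Type*) [mΩ : MeasurableSpace Ω] (P : Measure Ω) [IsProbabilityMeasure P]
        (ℱ : Filtration ℕ mΩ) (𝒲 : ℕ → Ω → Finset V) (X : ℕ → Ω → AgentConfig V),
        IsExecution G Δ w p sel σ₀ P ℱ 𝒲 X →
      ∀ T : ℕ, (∀ ω, (𝒲 T ω).Nonempty) → (∀ t ω, T ≤ t → 𝒲 t ω = 𝒲 T ω) →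
        ∫⁻ ω, awareTime (fun t => X t ω) T ∂P ≤ ENNReal.ofReal (C * (Fintype.card V : ℝ) ^ 5) := by
  refine ⟨awareConstant Δ w p, ?_⟩
  intro V _ _ _ G _ hG hdeg sel hsel σ₀ _ Ω _ P _ ℱ 𝒲 X hX T hne hconst
  have hw1 : (1 : ℝ) ≤ w := by exact_mod_cast hw
  have hpw1 : p * w < 1 := (lt_div_iff₀ (by linarith)).1 hpw
  have hp1 : p ≤ 1 := by nlinarith
  have hex : ∀ S : Finset V, ∃ H : AgentConfig V → ℝ, (∀ σ, 0 ≤ H σ) ∧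
      (∀ σ, H σ ≤ awareConstant Δ w p * (Fintype.card V : ℝ) ^ 5) ∧
      (∀ σ, (iteration G Δ p sel S σ).expect H + (if H σ = 0 then 0 else 1) ≤ H σ) ∧
      (S.Nonempty → S.card ≤ w → ∀ σ, H σ = 0 → AllAware σ) := by
    intro S
    by_cases hS : S.Nonempty ∧ S.card ≤ w
    · obtain ⟨H, h1, h2, h3, h4⟩ := exists_potential G sel hG hp0 hp1 hΔ
        (fun u => (G.degree_le_maxDegree u).trans hdeg) hsel hpw1 hS.1 hS.2
      exact ⟨H, h1, h2, h3, fun _ _ => h4⟩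
    -- Empty or too large sets never occur as the final witness set; the zero function satisfies the
    -- drift and the bound there, so that `H` is defined for every `S`.
    · refine ⟨fun _ => 0, fun _ => le_rfl, fun _ => ?_, fun σ => ?_, fun h1 h2 =>
        absurd ⟨h1, h2⟩ hS⟩
      · have : 0 < 1 - p * w := by linarith
        unfold awareConstant
        positivity
      · simp [PMF.expect]
  choose H h1 h2 h3 h4 using hex
  exact hX.lintegral_awareTime_le hconst h1 h3
    (fun ω => h4 _ (hne ω) (hX.card_le T ω)) h2
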